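/- Let $P$ be a simple $3$-dimensional convex polytope with $2n$ vertices whose facets are coloured with the colours $1,2,3$ so that any two facets sharing an edge have different colours. For a facet $f$ of $P$ let $\xi_f\in\{0,1\}^{V(P)}\subset\mathbb R^{V(P)}\cong\mathbb R^{2n}$ be its incidence vector ($\xi_f(v)=1$ iff $v\in f$). Let $S$ be the set of all the $\xi_f$, $V_i\subseteq S$ the set of those with $f$ of colour $i$, $m_i$ the number of facets of colour $i$, and $\widetilde P=\operatorname{conv}(S)$, a polytope with vertex set $S$. Suppose $m_3>m_2=m_1\ge 2$. Then the Gale diagram of $\widetilde P$ lies on a line and is unique up to reflection in $0$: the $m_3$ vertices in $V_3$ are at $0$, the $m_2$ vertices in $V_2$ are at $1$ and the $m_1$ vertices in $V_1$ are at $-1$. Moreover: (1) For $J\subsetneq S$, $\operatorname{conv}(J)$ is a proper face of $\widetilde P$ (the empty face being counted as proper) if and only if either $V_1\not\subseteq J$ and $V_2\not\subseteq J$, or $V_1\cup V_2\subseteq J$. (2) $\widetilde P$ is not simplicial. (3) $\widetilde P$ is an $n$-dimensional $m_3$-fold pyramid whose basis is combinatorially equivalent to $C(2m_2,2m_2-2)$,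 the cyclic polytope of dimension $2m_2-2$ with $2m_2$ vertices. It is of the combinatorial type $T^{n,m_3}_{m_2-1}$, that is, of an $m_3$-fold $n$-dimensional pyramid whose basis is the convex hull of an $(n-m_3)$-simplex and a point of its affine hull outside the simplex that is beyond exactly $m_2-1$ of its facets and beneath all the others. -/

import Mathlib

namespace ConvexPolytope

section General

variable {E : Type*} [AddCommGroup E] [Module ℝ E]

/-- A convex polytope: the convex hull of finitely many points. -/
def IsPolytope (Q : Set E) : Prop :=
  ∃ s : Finset E, Q = convexHull ℝ (s : Set E)

/-- The dimension of the affine hull of a (nonempty) set. -/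
noncomputable def polyDim (Q : Set E) : ℕ :=
  Module.finrank ℝ (vectorSpan ℝ Q)

/-- The set of vertices of a polytope. -/
def vertices (Q : Set E) : Set E :=
  Set.extremePoints ℝ Q

/-- A simplex: the convex hull of a finite affinely independent set
(the empty set is the simplex of dimension `-1`). -/
def IsSimplex (Q : Set E) : Prop :=
  ∃ t : Finset E, AffineIndependent ℝ (fun x : t => (x : E)) ∧ Q = convexHull ℝ (t : Set E)

/-- `Q` is an `r`-fold pyramid with basis `K`: starting from `K`, one takes `r` times the convex
hull with a further point (apex) outside the affine hull of the polytope reached so far. -/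
def IsFoldPyramid (K : Set E) : ℕ → Set E → Prop
  | 0, Q => Q = K
  | r + 1, Q => ∃ (K' : Set E) (A : E),
      IsFoldPyramid K r K' ∧ A ∉ affineSpan ℝ K' ∧ Q = convexHull ℝ (insert A K')

/-- The space of affine dependences of the points of `V`: the null space of the matrix whose
columns are `(1, v)`, `v ∈ V`. -/
noncomputable def affineDependences (V : Set E) : Submodule ℝ (V →₀ ℝ) :=
  LinearMap.ker (Finsupp.linearCombination ℝ (fun v : V => ((1 : ℝ), (v : E))))

/-- `g` is a Gale transform of `V`: for some basis `β 0, …, β (k-1)` of the space of affine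
dependences of `V` (so that `k = |V| - dim (conv V) - 1` for finite nonempty `V`), the point
assigned to `v` is the row `(β 0 v, …, β (k-1) v)`. -/
def IsGaleTransform {k : ℕ} (V : Set E) (g : V → EuclideanSpace ℝ (Fin k)) : Prop :=
  ∃ β : Module.Basis (Fin k) ℝ (affineDependences V),
    ∀ (v : V) (j : Fin k), g v j = (β j : V →₀ ℝ) v

/-- A Gale diagram of `V`: the nonzero points of a Gale transform are moved radially onto the unit
sphere, the points at the origin stay there. -/
def IsGaleDiagram {k : ℕ} (V : Set E) (g : V → EuclideanSpace ℝ (Fin k)) : Prop :=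
  ∃ h : V → EuclideanSpace ℝ (Fin k), IsGaleTransform V h ∧ ∀ v, g v = ‖h v‖⁻¹ • h v

variable [TopologicalSpace E]

/-- `F` is a face of `Q`: the empty set, or the set of maximizers on `Q` of a linear functional
(which may be zero, so that `Q` is a face of itself). -/
def IsFace (Q F : Set E) : Prop :=
  IsExposed ℝ Q F

/-- A proper face: a face other than `Q` (the empty face is counted as proper). -/
def IsProperFace (Q F : Set E) : Prop :=
  IsFace Q F ∧ F ≠ Q

/-- The facets of `Q`: the nonempty faces of codimension one. -/
def facets (Q : Set E) : Set (Set E) :=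
  {F | IsFace Q F ∧ F.Nonempty ∧ polyDim F + 1 = polyDim Q}

/-- A simple polytope: each vertex belongs to exactly `dim Q` facets. -/
def IsSimple (Q : Set E) : Prop :=
  ∀ v ∈ vertices Q, {F | F ∈ facets Q ∧ v ∈ F}.ncard = polyDim Q

/-- A simplicial polytope: all proper faces are simplices. -/
def IsSimplicial (Q : Set E) : Prop :=
  ∀ F, IsProperFace Q F → IsSimplex F

/-- Two distinct facets are adjacent if they meet in a face of codimension two of `Q`
(an edge, if `Q` is three-dimensional). -/
def AdjacentFacets (Q F G : Set E) : Prop :=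
  F ≠ G ∧ (F ∩ G).Nonempty ∧ polyDim (F ∩ G) + 2 = polyDim Q

/-- A colouring of the facets with three colours such that adjacent facets get different colours. -/
def IsFacetColoring (Q : Set E) (c : facets Q → Fin 3) : Prop :=
  ∀ F G : facets Q, AdjacentFacets Q F G → c F ≠ c G

/-- For a point `v` of the affine hull of `Q`: `v` is beyond the facet `F` of `Q`, that is, the
hyperplane of the affine hull of `Q` spanned by `F` strictly separates `v` from the rest of `Q`. -/
def IsBeyond (Q F : Set E) (v : E) : Prop :=
  ∃ l : E →L[ℝ] ℝ, F = {x | x ∈ Q ∧ ∀ y ∈ Q, l y ≤ l x} ∧ ∀ x ∈ F, l x < l v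

/-- For a point `v` of the affine hull of `Q`: `v` is beneath the facet `F` of `Q`, that is,
strictly on the same side of the hyperplane spanned by `F` as the rest of `Q`. -/
def IsBeneath (Q F : Set E) (v : E) : Prop :=
  ∃ l : E →L[ℝ] ℝ, F = {x | x ∈ Q ∧ ∀ y ∈ Q, l y ≤ l x} ∧ ∀ x ∈ F, l v < l x

/-- `Q` is a polytope `T^d_k`: the convex hull of a `d`-simplex `Δ` and a point `v ∉ Δ` of its
affine hull which is beyond exactly `k` facets of `Δ` and beneath all the others. -/
def IsT (d k : ℕ) (Q : Set E) : Prop :=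
  ∃ (Δ : Set E) (v : E), IsSimplex Δ ∧ polyDim Δ = d ∧ v ∈ affineSpan ℝ Δ ∧ v ∉ Δ ∧
    (∀ F ∈ facets Δ, IsBeyond Δ F v ∨ IsBeneath Δ F v) ∧
    {F | F ∈ facets Δ ∧ IsBeyond Δ F v}.ncard = k ∧
    Q = convexHull ℝ (insert v Δ)

/-- `Q` is a polytope `T^{d,r}_k`: an `r`-fold `d`-pyramid whose basis is a `T^{d-r}_k`. -/
def IsTPyramid (d r k : ℕ) (Q : Set E) : Prop :=
  ∃ (e : ℕ) (K : Set E), e + r = d ∧ IsT e k K ∧ IsFoldPyramid K r Q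

/-- Combinatorial equivalence: the face lattices (ordered by inclusion) are isomorphic. -/
def CombEquiv {E' : Type*} [AddCommGroup E'] [Module ℝ E'] [TopologicalSpace E']
    (Q : Set E) (R : Set E') : Prop :=
  Nonempty ({F : Set E // IsFace Q F} ≃o {G : Set E' // IsFace R G})

/-- The incidence vector `ξ_F` in `ℝ^{V(P)}` of a facet `F` of `P`. -/
noncomputable def incidenceVector (P F : Set E) : vertices P → ℝ :=
  fun v => F.indicator (fun _ => (1 : ℝ)) (v : E)

/-- The set `S` of the incidence vectors of all facets of `P`. -/
def incidenceSet (P : Set E) : Set (vertices P → ℝ) :=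
  incidenceVector P '' facets P

/-- The set `V_i` of the incidence vectors of the facets of colour `i`. -/
def colorVectors (P : Set E) (c : facets P → Fin 3) (i : Fin 3) : Set (vertices P → ℝ) :=
  {x | ∃ F : facets P, c F = i ∧ x = incidenceVector P F}

/-- The number `m_i` of facets of colour `i`. -/
noncomputable def colorCount (P : Set E) (c : facets P → Fin 3) (i : Fin 3) : ℕ :=
  {F : facets P | c F = i}.ncard

/-- The polytope `P̃`: the convex hull of the incidence vectors of the facets of `P`. -/
def incidencePolytope (P : Set E) : Set (vertices P → ℝ) :=
  convexHull ℝ (incidenceSet P)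

end General

/-- The cyclic polytope `C(N, d)`, as the convex hull of the points with parameters `t` on the
moment curve `s ↦ (s, s ^ 2, …, s ^ d)`. -/
def cyclicPolytope {N : ℕ} (d : ℕ) (t : Fin N → ℝ) : Set (EuclideanSpace ℝ (Fin d)) :=
  convexHull ℝ (Set.range fun i : Fin N =>
    (WithLp.toLp 2 (fun j : Fin d => t i ^ ((j : ℕ) + 1)) : EuclideanSpace ℝ (Fin d)))

open Classical in
/-- The points on the line: vectors of colour `2` at `0`, of colour `1` at `1`, the other vertices
at `-1` (colours are numbered `0`, `1`, `2`). -/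
noncomputable def lineDiagram {E : Type*} [AddCommGroup E] [Module ℝ E] [TopologicalSpace E]
    (P : Set E) (c : facets P → Fin 3) (w : vertices (incidencePolytope P)) :
    EuclideanSpace ℝ (Fin 1) :=
  if (w : vertices P → ℝ) ∈ colorVectors P c 2 then !₂[(0 : ℝ)]
  else if (w : vertices P → ℝ) ∈ colorVectors P c 1 then !₂[(1 : ℝ)]
  else !₂[(-1 : ℝ)]

end ConvexPolytope

open ConvexPolytope

open ConvexPolytope

namespace ConvexPolytope

open Filter Topology
open scoped RealInnerProductSpace

/-! All claims follow from the fact that the affine dependences of the incidence vectors form a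
line, spanned by a vector that depends only on the colour of a facet.

At a vertex `v` of `P` the three facets through `v` are pairwise adjacent, so each colour occurs
once, and a linear dependence `μ` of the incidence vectors says that the three values of `μ` at `v`
add up to zero. An edge keeps two of the three facets, so this relation forces the third value to
agree at both ends. The edge graph is connected, hence `μ` is a function `a` of the colour with `a 0
+ a 1 + a 2 = 0` (`exists_eq_comp_color`). An affine dependence also satisfies `∑ mᵢ aᵢ = 0` over
the three colour counts. Since two counts are equal and the third differs, the third coefficient
vanishes and `(-1, 1, 0)` spans all solutions (`incidence_isCircuitConfig`).

The rest is about any point configuration with a single dependence, having `p` positive, `q`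
negative and `r` zero coefficients. Its Gale diagram consists of the signs. A set of indices gives a
face iff it contains all positive indices exactly when it contains all negative ones (`isFace_iff`),
so the combinatorial type depends only on `(p, q, r)`. Points with coefficient zero are apexes of
pyramids. The cyclic polytope has such a dependence with alternating signs
(`cyclic_isCircuitConfig`), and a simplex with one extra point has one given by barycentric
coordinates (`IsT.exists_config`). The dimension is the number of points minus two, and Euler's
relation gives `n + 2` facets.

Facets are defined by dimension, so the local structure of `P` at a vertex must be derived; this
rests on `exists_facet_separating`. -/

theorem eventually_forall_mul_le {ι : Type*} (s : Finset ι) (a d : ι → ℝ)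
    (ha : ∀ i ∈ s, 0 ≤ a i) (h : ∀ i ∈ s, a i = 0 → d i ≤ 0) :
    ∀ᶠ δ in 𝓝[>] (0 : ℝ), ∀ i ∈ s, δ * d i ≤ a i := by
  rw [Filter.eventually_all_finset]
  intro i hi
  rcases (ha i hi).eq_or_lt with h0 | h0
  · filter_upwards [self_mem_nhdsWithin] with δ hδ
    have := h i hi h0.symm
    rw [← h0]
    exact mul_nonpos_of_nonneg_of_nonpos (le_of_lt hδ) this
  · have : Tendsto (fun δ : ℝ => δ * d i) (𝓝[>] 0) (𝓝 0) := by
      have : Tendsto (fun δ : ℝ => δ * d i) (𝓝 0) (𝓝 (0 * d i)) :=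
        (continuous_id.mul continuous_const).tendsto 0
      rw [zero_mul] at this
      exact this.mono_left nhdsWithin_le_nhds
    exact (this.eventually_lt_const h0).mono fun _ => le_of_lt

/-! ### Separating an outside point from a polytope by a facet. -/

section Weyl

variable {E : Type*} [NormedAddCommGroup E] [InnerProductSpace ℝ E] [FiniteDimensional ℝ E]

theorem exists_relative_ball {P : Set E} (hc : Convex ℝ P) (hne : P.Nonempty) :
    ∃ p ∈ P, ∃ r > 0, ∀ w ∈ vectorSpan ℝ P, ‖w‖ ≤ r → p + w ∈ P := by
  obtain ⟨p, hp⟩ := hne.intrinsicInterior hc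
  obtain ⟨q, hq, rfl⟩ := mem_intrinsicInterior.1 hp
  rw [mem_interior_iff_mem_nhds, Metric.mem_nhds_iff] at hq
  obtain ⟨r, hr, hball⟩ := hq
  refine ⟨q, intrinsicInterior_subset hp, r / 2, by positivity, fun w hw hwr => ?_⟩
  have hmem : w +ᵥ (q : E) ∈ affineSpan ℝ P :=
    AffineSubspace.vadd_mem_of_mem_direction (by rwa [direction_affineSpan]) q.2
  have := hball (show (⟨w +ᵥ (q : E), hmem⟩ : affineSpan ℝ P) ∈ Metric.ball q r by
    rw [Metric.mem_ball, Subtype.dist_eq, dist_eq_norm]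
    simp only [vadd_eq_add, add_sub_cancel_right]
    linarith)
  simpa [add_comm] using this

/-- The set `D` of `u ∈ W` satisfying the inequalities is the polar of `s` about `p`, compact
because of the ball around `p`. Hahn–Banach gives a point of `D` with value above 1 at `x`; an
extreme point of the face of `D` maximising this value is a vertex of `D`. The constraints tight at
a vertex leave no direction free. -/
theorem exists_dual_vertex {s : Finset E} {W : Submodule ℝ E} {p x : E} {r : ℝ} (hr : 0 < r)
    (hball : ∀ w ∈ W, ‖w‖ ≤ r → p + w ∈ convexHull ℝ (s : Set E))
    (hs : ∀ y ∈ s, y - p ∈ W) (hx : x - p ∈ W) (hxs : x ∉ convexHull ℝ (s : Set E)) :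
    ∃ u ∈ W, (∀ y ∈ s, ⟪u, y - p⟫ ≤ 1) ∧ 1 < ⟪u, x - p⟫ ∧
      ∀ d ∈ W, (∀ y ∈ s, ⟪u, y - p⟫ = 1 → ⟪d, y - p⟫ = 0) → d = 0 := by
  set C := convexHull ℝ (s : Set E) with hC
  have hCcomp : IsCompact C := s.finite_toSet.isCompact_convexHull ℝ
  set D : Set E := {u | u ∈ W ∧ ∀ y ∈ s, ⟪u, y - p⟫ ≤ 1} with hD
  have hDC : ∀ u ∈ D, ∀ y ∈ C, ⟪u, y - p⟫ ≤ 1 := by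
    rintro u ⟨-, hu⟩ y hy
    have hconv : Convex ℝ {y : E | ⟪u, y⟫ ≤ 1 + ⟪u, p⟫} :=
      convex_halfSpace_le (IsLinearMap.mk (fun a b => inner_add_right _ _ _)
        (fun c a => by simp [inner_smul_right])) _
    have hsub : C ⊆ {y : E | ⟪u, y⟫ ≤ 1 + ⟪u, p⟫} := convexHull_min (fun y hy => by
      have := hu y hy
      rw [inner_sub_right] at this
      simp only [Set.mem_ofPred_eq]
      linarith) hconv
    have := hsub hy
    rw [inner_sub_right]
    simp only [Set.mem_ofPred_eq] at this
    linarith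
  have hDclosed : IsClosed D := by
    have h1 : IsClosed (W : Set E) := W.closed_of_finiteDimensional
    have h2 : IsClosed (⋂ y ∈ s, {u : E | ⟪u, y - p⟫ ≤ 1}) :=
      isClosed_biInter fun y _ => isClosed_le (by fun_prop) continuous_const
    convert h1.inter h2 using 1
    ext u; simp [hD]
  have hDbdd : Bornology.IsBounded D := by
    rw [isBounded_iff_forall_norm_le]
    refine ⟨1 / r, fun u hu => ?_⟩
    rw [le_div_iff₀ hr]
    by_cases h0 : u = 0
    · simp [h0]
    have hn : 0 < ‖u‖ := norm_pos_iff.2 h0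
    have hmem : p + (r / ‖u‖) • u ∈ C := hball _ (W.smul_mem _ hu.1) (by
      rw [norm_smul, Real.norm_eq_abs, abs_of_pos (by positivity)]
      field_simp; exact le_rfl)
    have := hDC u hu _ hmem
    rw [add_sub_cancel_left, inner_smul_right, real_inner_self_eq_norm_sq] at this
    have h3 : r / ‖u‖ * ‖u‖ ^ 2 = ‖u‖ * r := by field_simp
    linarith
  have hDcomp : IsCompact D := Metric.isCompact_of_isClosed_isBounded hDclosed hDbdd
  have hpC : p ∈ C := by simpa using hball 0 W.zero_mem (by simpa using hr.le)
  obtain ⟨u₀, hu₀, hu₀x⟩ : ∃ u ∈ D, 1 < ⟪u, x - p⟫ := by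
    obtain ⟨f, m, hf, hfx⟩ := geometric_hahn_banach_closed_point (convex_convexHull ℝ _)
      hCcomp.isClosed hxs
    have hm : 0 < m - f p := sub_pos.2 (hf p hpC)
    set v : E := (InnerProductSpace.toDual ℝ E).symm f with hv
    have hvf : ∀ y, ⟪v, y⟫ = f y := fun y => by rw [hv, InnerProductSpace.toDual_symm_apply]
    -- The separating functional is represented by a vector of `E`; projecting it to `W` does not
    -- change its values on `W`.
    have hproj : ∀ w ∈ W, ⟪(W.orthogonalProjectionOnto v : E), w⟫ = f w := fun w hw => by
      rw [← hvf w]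
      have := W.inner_orthogonalProjectionOnto_eq_of_mem_left ⟨w, hw⟩ v
      rw [real_inner_comm, real_inner_comm w v]
      exact this
    refine ⟨(m - f p)⁻¹ • (W.orthogonalProjectionOnto v : E),
      ⟨W.smul_mem _ (Submodule.coe_mem _), fun y hy => ?_⟩, ?_⟩
    · rw [real_inner_smul_left, hproj _ (hs y hy), inv_mul_le_iff₀ hm, map_sub]
      have := hf y (subset_convexHull ℝ _ hy)
      linarith
    · rw [real_inner_smul_left, hproj _ hx, lt_inv_mul_iff₀ hm, map_sub]
      linarith
  have hcont : ContinuousOn (fun u : E => ⟪u, x - p⟫) D := by fun_prop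
  set l : StrongDual ℝ E := innerSL ℝ (x - p) with hl
  have hlv : ∀ u, l u = ⟪u, x - p⟫ := fun u => by rw [hl, innerSL_apply_apply, real_inner_comm]
  have hexp : IsExposed ℝ D (l.toExposed D) := ContinuousLinearMap.toExposed.isExposed
  have hne : (l.toExposed D).Nonempty := by
    obtain ⟨u, hu, hmax⟩ := hDcomp.exists_isMaxOn ⟨u₀, hu₀⟩ hcont
    exact ⟨u, hu, fun y hy => by simpa [hlv] using hmax hy⟩
  obtain ⟨u, hu⟩ := (hexp.isCompact hDcomp).extremePoints_nonempty hne
  have huD := hexp.isExtreme.extremePoints_subset_extremePoints hu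
  have humax := (extremePoints_subset hu).2 u₀ hu₀
  rw [hlv, hlv] at humax
  refine ⟨u, huD.1.1, huD.1.2, by linarith, fun d hd hd0 => ?_⟩
  by_contra hne
  have e1 := eventually_forall_mul_le s (fun y => 1 - ⟪u, y - p⟫) (fun y => ⟪d, y - p⟫)
    (fun y hy => sub_nonneg.2 (huD.1.2 y hy)) (fun y hy h => (hd0 y hy (by linarith)).le)
  have e2 := eventually_forall_mul_le s (fun y => 1 - ⟪u, y - p⟫) (fun y => -⟪d, y - p⟫)
    (fun y hy => sub_nonneg.2 (huD.1.2 y hy)) (fun y hy h => by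
      rw [hd0 y hy (by linarith), neg_zero])
  obtain ⟨δ, ⟨h1, h2⟩, hδ⟩ := ((e1.and e2).and self_mem_nhdsWithin).exists
  have hδ : 0 < δ := hδ
  have m1 : u + δ • d ∈ D := ⟨W.add_mem huD.1.1 (W.smul_mem _ hd), fun y hy => by
    have := h1 y hy
    rw [inner_add_left, real_inner_smul_left]; linarith⟩
  have m2 : u - δ • d ∈ D := ⟨W.sub_mem huD.1.1 (W.smul_mem _ hd), fun y hy => by
    have := h2 y hy
    rw [inner_sub_left, real_inner_smul_left]; linarith⟩
  -- `u` is the midpoint of `u ± δ • d`, both in `D`, so extremality forces `d = 0`.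
  have := huD.2 m1 m2 ⟨1 / 2, 1 / 2, by norm_num, by norm_num, by norm_num, by module⟩
  exact hne (by simpa [hδ.ne'] using this)

/-- A point of the affine hull of a polytope that is outside of it is beyond some facet. -/
theorem exists_facet_separating {P : Set E} (hP : IsPolytope P) (hne : P.Nonempty) {x : E}
    (hx : x ∈ affineSpan ℝ P) (hxP : x ∉ P) :
    ∃ l : StrongDual ℝ E, {y | y ∈ P ∧ ∀ z ∈ P, l z ≤ l y} ∈ facets P ∧ ∀ y ∈ P, l y < l x := by
  obtain ⟨s, rfl⟩ := hP
  set P := convexHull ℝ (s : Set E) with hPdef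
  obtain ⟨p, hp, r, hr, hball⟩ := exists_relative_ball (convex_convexHull ℝ _) hne
  have hW : ∀ y ∈ affineSpan ℝ P, y - p ∈ vectorSpan ℝ P := fun y hy => by
    have := AffineSubspace.vsub_mem_direction hy (mem_affineSpan ℝ hp)
    rwa [direction_affineSpan] at this
  have hsP : ∀ y ∈ s, y ∈ P := fun y hy => subset_convexHull ℝ _ hy
  obtain ⟨u, huW, hu1, hux, hu0⟩ := exists_dual_vertex hr hball
    (fun y hy => hW y (mem_affineSpan ℝ (hsP y hy))) (hW x hx) hxP
  have hle : ∀ y ∈ P, ⟪u, y⟫ ≤ 1 + ⟪u, p⟫ := by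
    have hconv : Convex ℝ {y : E | ⟪u, y⟫ ≤ 1 + ⟪u, p⟫} :=
      convex_halfSpace_le (IsLinearMap.mk (fun a b => inner_add_right _ _ _)
        (fun c a => by simp [inner_smul_right])) _
    have hsub : P ⊆ {y : E | ⟪u, y⟫ ≤ 1 + ⟪u, p⟫} := convexHull_min (fun y hy => by
      have := hu1 y hy
      rw [inner_sub_right] at this
      simp only [Set.mem_ofPred_eq]
      linarith) hconv
    exact fun y hy => hsub hy
  have hxne : x - p ≠ 0 := fun h => by rw [h, inner_zero_right] at hux; linarith
  obtain ⟨y₀, hy₀, hy₀1⟩ : ∃ y ∈ s, ⟪u, y - p⟫ = 1 := by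
    by_contra! hcon
    exact hxne (hu0 _ (hW x hx) fun y hy h => absurd h (hcon y hy))
  have hy₀' : ⟪u, y₀⟫ = 1 + ⟪u, p⟫ := by rw [inner_sub_right] at hy₀1; linarith
  set F := {y | y ∈ P ∧ ∀ z ∈ P, innerSL ℝ u z ≤ innerSL ℝ u y} with hF
  have hFmem : ∀ y, y ∈ F ↔ y ∈ P ∧ ⟪u, y⟫ = 1 + ⟪u, p⟫ := fun y => by
    simp only [hF, Set.mem_ofPred_eq, innerSL_apply_apply]
    constructor
    · rintro ⟨h1, h2⟩
      exact ⟨h1, le_antisymm (hle y h1) (by rw [← hy₀']; exact h2 _ (hsP _ hy₀))⟩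
    · rintro ⟨h1, h2⟩
      exact ⟨h1, fun z hz => by rw [h2]; exact hle z hz⟩
  have hy₀F : y₀ ∈ F := (hFmem _).2 ⟨hsP _ hy₀, hy₀'⟩
  refine ⟨innerSL ℝ u, ⟨fun _ => ⟨_, rfl⟩, ⟨y₀, hy₀F⟩, ?_⟩, fun y hy => ?_⟩
  · have hFP : vectorSpan ℝ F ≤ vectorSpan ℝ P := vectorSpan_mono ℝ fun y hy => hy.1
    have hperp : ∀ w ∈ vectorSpan ℝ F, ⟪u, w⟫ = 0 := by
      have : vectorSpan ℝ F ≤ LinearMap.ker (innerSL ℝ u : E →ₗ[ℝ] ℝ) := by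
        rw [vectorSpan_def, Submodule.span_le]
        rintro _ ⟨a, ha, b, hb, rfl⟩
        simp [inner_sub_right, ((hFmem a).1 ha).2, ((hFmem b).1 hb).2]
      intro w hw
      simpa using this hw
    have hy₀W := hW y₀ (mem_affineSpan ℝ (hsP _ hy₀))
    have hlt : vectorSpan ℝ F < vectorSpan ℝ P := lt_of_le_of_ne hFP fun h => by
      have := hperp _ (h ▸ hy₀W)
      linarith
    -- The tight points of `s` lie in `F`, so a vector of the direction space orthogonal to `K` is
    -- zero by `hu0`. Thus `F` together with one further direction spans everything, which gives
    -- codimension one.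
    have hle : vectorSpan ℝ P ≤ vectorSpan ℝ F ⊔ Submodule.span ℝ {y₀ - p} := by
      set K := vectorSpan ℝ F ⊔ Submodule.span ℝ {y₀ - p} with hK
      have hKW : K ≤ vectorSpan ℝ P := sup_le hFP (by
        rw [Submodule.span_singleton_le_iff_mem]; exact hy₀W)
      have h0 : Kᗮ ⊓ vectorSpan ℝ P = ⊥ := by
        rw [eq_bot_iff]
        rintro d ⟨hd1, hd2⟩
        refine hu0 d hd2 fun y hy h1 => ?_
        have hyF : y ∈ F := (hFmem _).2 ⟨hsP _ hy, by rw [inner_sub_right] at h1; linarith⟩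
        have hmem : y - p ∈ K := by
          have : y - p = (y - y₀) + (y₀ - p) := by abel
          rw [this]
          exact Submodule.add_mem_sup (vsub_mem_vectorSpan ℝ hyF hy₀F)
            (Submodule.mem_span_singleton_self _)
        rw [real_inner_comm]
        exact hd1 _ hmem
      have := Submodule.sup_orthogonal_inf_of_hasOrthogonalProjection hKW
      rw [h0, sup_bot_eq] at this
      exact this.ge
    have h1 := Submodule.finrank_lt_finrank_of_lt hlt
    have h2 := Submodule.finrank_mono hle
    have h3 := Submodule.finrank_add_le_finrank_add_finrank (vectorSpan ℝ F)
      (Submodule.span ℝ {y₀ - p})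
    have h4 := finrank_span_singleton (K := ℝ) (v := y₀ - p) (fun h => by
      rw [h, inner_zero_right] at hy₀1; exact zero_ne_one hy₀1)
    change Module.finrank ℝ (vectorSpan ℝ F) + 1 = Module.finrank ℝ (vectorSpan ℝ P)
    omega
  · rw [innerSL_apply_apply, innerSL_apply_apply]
    have := hle y hy
    rw [inner_sub_right] at hux
    linarith

end Weyl

end ConvexPolytope

namespace ConvexPolytope

open Filter Topology
open scoped RealInnerProductSpace

/-! ### Faces, feasible directions and the three edges at a vertex of a simple polytope. -/

section Polytope

variable {E : Type*} [NormedAddCommGroup E] [InnerProductSpace ℝ E]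
  {P : Set E}

theorem IsPolytope.isCompact (hP : IsPolytope P) : IsCompact P := by
  obtain ⟨s, rfl⟩ := hP
  exact s.finite_toSet.isCompact_convexHull ℝ

theorem IsPolytope.convex (hP : IsPolytope P) : Convex ℝ P := by
  obtain ⟨s, rfl⟩ := hP
  exact convex_convexHull ℝ _

theorem IsPolytope.finite_vertices (hP : IsPolytope P) : (vertices P).Finite := by
  obtain ⟨s, rfl⟩ := hP
  exact s.finite_toSet.subset extremePoints_convexHull_subset

/-- Krein–Milman for the face; the closure is superfluous as there are finitely many vertices. -/
theorem IsFace.eq_convexHull (hP : IsPolytope P) {F : Set E} (hF : IsFace P F) :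
    F = convexHull ℝ (F ∩ vertices P) := by
  have hF' : IsExposed ℝ P F := hF
  have h := closure_convexHull_extremePoints (hF'.isCompact hP.isCompact) (hF'.convex hP.convex)
  rw [hF'.isExtreme.extremePoints_eq] at h
  have hfin : (F ∩ vertices P).Finite := hP.finite_vertices.subset Set.inter_subset_right
  rw [show F ∩ Set.extremePoints ℝ P = F ∩ vertices P from rfl,
    (hfin.isCompact_convexHull ℝ).isClosed.closure_eq] at h
  exact h.symm

theorem IsFace.ext_vertices (hP : IsPolytope P) {F G : Set E} (hF : IsFace P F) (hG : IsFace P G)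
    (h : ∀ v ∈ vertices P, v ∈ F ↔ v ∈ G) : F = G := by
  rw [hF.eq_convexHull hP, hG.eq_convexHull hP]
  congr 1
  ext v
  exact ⟨fun hv => ⟨(h v hv.2).1 hv.1, hv.2⟩, fun hv => ⟨(h v hv.2).2 hv.1, hv.2⟩⟩

theorem IsPolytope.finite_facets (hP : IsPolytope P) : (facets P).Finite := by
  refine (hP.finite_vertices.finite_subsets.image (convexHull ℝ)).subset fun F hF => ?_
  exact ⟨F ∩ vertices P, Set.inter_subset_right, (hF.1.eq_convexHull hP).symm⟩

theorem exists_mem_vertices_of_isFace (hP : IsPolytope P) {F : Set E} (hF : IsFace P F)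
    (hne : F.Nonempty) : ∃ v ∈ vertices P, v ∈ F := by
  rw [hF.eq_convexHull hP, convexHull_nonempty_iff] at hne
  obtain ⟨v, h1, h2⟩ := hne
  exact ⟨v, h2, h1⟩

theorem sub_mem_vectorSpan_of_mem_affineSpan {x y : E} (hx : x ∈ affineSpan ℝ P)
    (hy : y ∈ affineSpan ℝ P) : x - y ∈ vectorSpan ℝ P := by
  have := AffineSubspace.vsub_mem_direction hx hy
  rwa [direction_affineSpan] at this

/-- Two functionals exposing the same facet have the same strictly positive side. -/
theorem lt_of_lt_of_facet [FiniteDimensional ℝ E] {F : Set E} (hF : F ∈ facets P)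
    {l l' : StrongDual ℝ E}
    (hl : F = {y | y ∈ P ∧ ∀ z ∈ P, l z ≤ l y}) (hl' : F = {y | y ∈ P ∧ ∀ z ∈ P, l' z ≤ l' y})
    {x y : E} (hx : x ∈ affineSpan ℝ P) (hy : y ∈ F) (h : l y < l x) : l' y < l' x := by
  have key : ∀ m : StrongDual ℝ E, F = {y | y ∈ P ∧ ∀ z ∈ P, m z ≤ m y} →
      (∀ w ∈ vectorSpan ℝ F, m w = 0) ∧ ∀ z ∈ P, z ∉ F → m (z - y) < 0 := by
    intro m hm
    have hmem : ∀ a ∈ F, a ∈ P ∧ ∀ z ∈ P, m z ≤ m a := fun a ha => by rwa [hm] at ha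
    refine ⟨?_, fun z hz hzF => ?_⟩
    · have : vectorSpan ℝ F ≤ LinearMap.ker (m : E →ₗ[ℝ] ℝ) := by
        rw [vectorSpan_def, Submodule.span_le]
        rintro _ ⟨a, ha, b, hb, rfl⟩
        simp [le_antisymm ((hmem b hb).2 a (hmem a ha).1) ((hmem a ha).2 b (hmem b hb).1)]
      exact fun w hw => by simpa using this hw
    · rw [map_sub, sub_neg]
      refine lt_of_le_of_ne ((hmem y hy).2 z hz) fun heq => hzF ?_
      rw [hm]
      exact ⟨hz, fun w hw => by rw [heq]; exact (hmem y hy).2 w hw⟩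
  obtain ⟨h1, h2⟩ := key l hl
  obtain ⟨h1', h2'⟩ := key l' hl'
  have hFP : F ⊆ P := fun a ha => by rw [hl] at ha; exact ha.1
  obtain ⟨z, hz, hzF⟩ : ∃ z ∈ P, z ∉ F := by
    by_contra! hcon
    have hd := hF.2.2
    rw [Set.Subset.antisymm hFP hcon] at hd
    omega
  -- Codimension one means that one inward vector `z - y` completes the directions of `F`. Both
  -- functionals vanish on those and are negative on `z - y`, so the coefficient `t` of `z - y` in
  -- `x - y` determines both signs.
  have hspan : vectorSpan ℝ F ⊔ Submodule.span ℝ {z - y} = vectorSpan ℝ P := by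
    apply Submodule.eq_of_le_of_finrank_le
    · refine sup_le (vectorSpan_mono ℝ hFP) ?_
      rw [Submodule.span_singleton_le_iff_mem]
      exact vsub_mem_vectorSpan ℝ hz (hFP hy)
    · have hlt : vectorSpan ℝ F < vectorSpan ℝ F ⊔ Submodule.span ℝ {z - y} := by
        refine lt_of_le_of_ne le_sup_left fun heq => ?_
        have hm : z - y ∈ vectorSpan ℝ F :=
          heq ▸ Submodule.mem_sup_right (Submodule.mem_span_singleton_self _)
        exact (h2 z hz hzF).ne (h1 _ hm)
      have h3 := Submodule.finrank_lt_finrank_of_lt hlt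
      have hd : Module.finrank ℝ (vectorSpan ℝ F) + 1 = Module.finrank ℝ (vectorSpan ℝ P) := hF.2.2
      omega
  have hxy := sub_mem_vectorSpan_of_mem_affineSpan hx (mem_affineSpan ℝ (hFP hy))
  rw [← hspan, Submodule.mem_sup] at hxy
  obtain ⟨w, hw, q, hq, hwq⟩ := hxy
  obtain ⟨t, rfl⟩ := Submodule.mem_span_singleton.1 hq
  have e1 : l x - l y = t * l (z - y) := by
    rw [← map_sub, ← hwq, map_add, h1 w hw, zero_add, map_smul, smul_eq_mul]
  have e2 : l' x - l' y = t * l' (z - y) := by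
    rw [← map_sub, ← hwq, map_add, h1' w hw, zero_add, map_smul, smul_eq_mul]
  have ht : t < 0 := by
    by_contra! ht
    nlinarith [h2 z hz hzF]
  nlinarith [h2' z hz hzF]

/-- A direction that is weakly inward for all facets through `v` is feasible at `v`. -/
theorem eventually_add_smul_mem [FiniteDimensional ℝ E] (hP : IsPolytope P) {v d : E} (hv : v ∈ P)
    (hd : d ∈ vectorSpan ℝ P)
    (h : ∀ F ∈ facets P, v ∈ F →
      ∃ l : StrongDual ℝ E, F = {y | y ∈ P ∧ ∀ z ∈ P, l z ≤ l y} ∧ l d ≤ 0) :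
    ∀ᶠ δ in 𝓝[>] (0 : ℝ), v + δ • d ∈ P := by
  have hl : ∀ F : facets P, ∃ l : StrongDual ℝ E, F.1 = {y | y ∈ P ∧ ∀ z ∈ P, l z ≤ l y} ∧
      (v ∈ F.1 → l d ≤ 0) := fun F => by
    by_cases hvF : v ∈ F.1
    · obtain ⟨l, h1, h2⟩ := h F.1 F.2 hvF
      exact ⟨l, h1, fun _ => h2⟩
    · obtain ⟨l, h1⟩ := F.2.1 F.2.2.1
      exact ⟨l, h1, fun h => absurd h hvF⟩
  choose l hlF hld using hl
  have hy : ∀ F : facets P, ∃ y, y ∈ F.1 := fun F => F.2.2.1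
  choose y hyF using hy
  have hymax : ∀ F, ∀ z ∈ P, l F z ≤ l F (y F) := fun F => by
    have := hyF F
    rw [hlF F] at this
    exact this.2
  have := hP.finite_facets.to_subtype
  have := Fintype.ofFinite (facets P)
  have ev := eventually_forall_mul_le Finset.univ (fun F => l F (y F) - l F v) (fun F => l F d)
    (fun F _ => sub_nonneg.2 (hymax F v hv)) (fun F _ h0 => hld F (by
      rw [hlF F]
      exact ⟨hv, fun z hz => by
        have := hymax F z hz
        linarith⟩))
  filter_upwards [ev] with δ hδ
  by_contra hcon
  have haff : v + δ • d ∈ affineSpan ℝ P := by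
    rw [add_comm, ← vadd_eq_add]
    refine AffineSubspace.vadd_mem_of_mem_direction ?_ (mem_affineSpan ℝ hv)
    rw [direction_affineSpan]
    exact Submodule.smul_mem _ _ hd
  -- The functional `m` separating the point need not be the one chosen for its facet, but
  -- `lt_of_lt_of_facet` transfers the strict inequality to the chosen one, contradicting `hδ`.
  obtain ⟨m, hm, hmlt⟩ := exists_facet_separating hP ⟨v, hv⟩ haff hcon
  set F : facets P := ⟨_, hm⟩ with hF
  have hyP : y F ∈ P := (hyF F).1
  have := lt_of_lt_of_facet hm rfl (hlF F) haff (hyF F) (hmlt _ hyP)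
  have h3 := hδ F (Finset.mem_univ _)
  rw [map_add, map_smul, smul_eq_mul] at this
  linarith

/-- The facets at a vertex of a simple three-dimensional polytope, with functionals exposing them
and the dual basis of edge directions. -/
structure VertexFrame (P : Set E) (v : E) where
  facet : Fin 3 → facets P
  functional : Fin 3 → StrongDual ℝ E
  dir : Fin 3 → E
  facet_injective : Function.Injective facet
  mem_facet : ∀ i, v ∈ (facet i : Set E)
  exhaust : ∀ G : facets P, v ∈ (G : Set E) → ∃ i, G = facet i
  mem_facet_iff : ∀ i x, x ∈ (facet i : Set E) ↔ x ∈ P ∧ functional i x = functional i v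
  functional_le : ∀ i, ∀ x ∈ P, functional i x ≤ functional i v
  functional_dir : ∀ i j, functional i (dir j) = if i = j then -1 else 0
  feasible : ∀ j, ∀ᶠ δ in 𝓝[>] (0 : ℝ), v + δ • dir j ∈ P
  sub_eq : ∀ x ∈ P, x - v = ∑ i, (functional i v - functional i x) • dir i

/-- The three functionals embed the direction space into `ℝ³`: a direction killed by all of them is
feasible together with its negative, which extremality of `v` forbids. By equality of dimensions
this is an isomorphism, and the edge directions are the preimages of the negatives of the standard
basis vectors. -/
theorem exists_vertexFrame [FiniteDimensional ℝ E] (hP : IsPolytope P) (hdim : polyDim P = 3)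
    (hsimple : IsSimple P) {v : E} (hv : v ∈ vertices P) : Nonempty (VertexFrame P v) := by
  have hvP : v ∈ P := hv.1
  have hcard : Nat.card {F | F ∈ facets P ∧ v ∈ F} = 3 := by
    have := hsimple v hv
    rwa [hdim] at this
  have : Finite {F | F ∈ facets P ∧ v ∈ F} := Nat.finite_of_card_ne_zero (by omega)
  let e : {F | F ∈ facets P ∧ v ∈ F} ≃ Fin 3 := Finite.equivFinOfCardEq hcard
  let f : Fin 3 → facets P := fun i => ⟨(e.symm i).1, (e.symm i).2.1⟩
  have hvf : ∀ i, v ∈ (f i : Set E) := fun i => (e.symm i).2.2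
  have hl : ∀ i, ∃ l : StrongDual ℝ E, (f i).1 = {y | y ∈ P ∧ ∀ z ∈ P, l z ≤ l y} :=
    fun i => (f i).2.1 (f i).2.2.1
  choose l hl using hl
  have hlv : ∀ i, ∀ x ∈ P, l i x ≤ l i v := fun i x hx => by
    have := hvf i
    rw [hl i] at this
    exact this.2 x hx
  have hexh : ∀ G : facets P, v ∈ (G : Set E) → ∃ i, G = f i := fun G hG =>
    ⟨e ⟨G.1, G.2, hG⟩, by ext1; simp [f]⟩
  have hfeas : ∀ d ∈ vectorSpan ℝ P, (∀ i, l i d ≤ 0) →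
      ∀ᶠ δ in 𝓝[>] (0 : ℝ), v + δ • d ∈ P := fun d hd h =>
    eventually_add_smul_mem hP hvP hd fun F hF hvF => by
      obtain ⟨i, hi⟩ := hexh ⟨F, hF⟩ hvF
      exact ⟨l i, by rw [← hl i, ← hi], h i⟩
  let L : vectorSpan ℝ P →ₗ[ℝ] (Fin 3 → ℝ) :=
    LinearMap.pi fun i => (l i : E →ₗ[ℝ] ℝ) ∘ₗ (vectorSpan ℝ P).subtype
  have hL : ∀ w i, L w i = l i w := fun w i => rfl
  have hinj : Function.Injective L := by
    rw [injective_iff_map_eq_zero]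
    intro w hw
    have hw0 : ∀ i, l i w = 0 := fun i => by rw [← hL, hw]; rfl
    have h1 := hfeas w w.2 fun i => (hw0 i).le
    have h2 := hfeas (-w) (Submodule.neg_mem _ w.2) fun i => by rw [map_neg, hw0 i, neg_zero]
    obtain ⟨δ, ⟨m1, m2⟩, hδ⟩ := ((h1.and h2).and self_mem_nhdsWithin).exists
    have hδ : 0 < δ := hδ
    have := hv.2 m1 m2 ⟨1 / 2, 1 / 2, by norm_num, by norm_num, by norm_num, by module⟩
    simpa [hδ.ne'] using this
  have hsurj : Function.Surjective L := by
    rw [← LinearMap.injective_iff_surjective_of_finrank_eq_finrank]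
    · exact hinj
    · rw [Module.finrank_fin_fun]; exact hdim
  choose d hd using fun j : Fin 3 => hsurj (fun i => if i = j then -1 else 0)
  have hld : ∀ i j, l i (d j) = if i = j then -1 else 0 := fun i j => by rw [← hL, hd]
  refine ⟨⟨f, l, fun j => d j, fun i j hij => ?_, hvf, hexh, fun i x => ?_, hlv, hld, fun j => ?_,
    fun x hx => ?_⟩⟩
  · have : (e.symm i).1 = (e.symm j).1 := congrArg (fun G : facets P => (G : Set E)) hij
    exact e.symm.injective (Subtype.ext this)
  · rw [hl i]
    constructor
    · rintro ⟨h1, h2⟩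
      exact ⟨h1, le_antisymm (hlv i x h1) (h2 v hvP)⟩
    · rintro ⟨h1, h2⟩
      exact ⟨h1, fun z hz => by rw [h2]; exact hlv i z hz⟩
  · exact hfeas _ (d j).2 fun i => by rw [hld]; split_ifs <;> norm_num
  · have hxv : x - v ∈ vectorSpan ℝ P := vsub_mem_vectorSpan ℝ hx hvP
    have : (⟨x - v, hxv⟩ : vectorSpan ℝ P) = ∑ i, (l i v - l i x) • d i := by
      apply hinj
      ext i
      rw [map_sum, Finset.sum_apply]
      simp [hL, hld, map_sub]
    simpa using congrArg Subtype.val this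

namespace VertexFrame

variable {v : E} (f : VertexFrame P v)

theorem mem (f : VertexFrame P v) : v ∈ P := ((f.mem_facet_iff 0 v).1 (f.mem_facet 0)).1

/-- The frame with its facets permuted. -/
def reindex (σ : Equiv.Perm (Fin 3)) : VertexFrame P v where
  facet i := f.facet (σ i)
  functional i := f.functional (σ i)
  dir i := f.dir (σ i)
  facet_injective := f.facet_injective.comp σ.injective
  mem_facet i := f.mem_facet _
  exhaust G hG := by
    obtain ⟨i, hi⟩ := f.exhaust G hG
    exact ⟨σ.symm i, by simpa using hi⟩
  mem_facet_iff i := f.mem_facet_iff _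
  functional_le i := f.functional_le _
  functional_dir i j := by simp [f.functional_dir]
  feasible j := f.feasible _
  sub_eq x hx := by
    rw [f.sub_eq x hx]
    exact (Equiv.sum_comp σ fun i => (f.functional i v - f.functional i x) • f.dir i).symm

theorem functional_add_smul (i j : Fin 3) (t : ℝ) :
    f.functional i (v + t • f.dir j) = f.functional i v - if i = j then t else 0 := by
  rw [map_add, map_smul, f.functional_dir]
  split_ifs <;> simp [sub_eq_add_neg]

theorem dir_ne_zero (j : Fin 3) : f.dir j ≠ 0 := fun h => by
  have := f.functional_dir j j
  simp [h] at this

theorem exists_pos_add_smul_mem (j : Fin 3) : ∃ δ > (0 : ℝ), v + δ • f.dir j ∈ P := by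
  obtain ⟨δ, h, hδ⟩ := ((f.feasible j).and self_mem_nhdsWithin).exists
  exact ⟨δ, hδ, h⟩

theorem sub_eq_smul {j : Fin 3} {x : E} (hx : x ∈ P)
    (h : ∀ i, i ≠ j → f.functional i x = f.functional i v) :
    x - v = (f.functional j v - f.functional j x) • f.dir j := by
  rw [f.sub_eq x hx, Finset.sum_eq_single j]
  · intro i _ hij
    rw [h i hij, sub_self, zero_smul]
  · simp

/-- The intersection of two facets at `v` spans exactly the line of the remaining direction, which
is feasible; so it has dimension one. -/
theorem adjacentFacets (hdim : polyDim P = 3) {i j : Fin 3} (hij : i ≠ j) :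
    AdjacentFacets P (f.facet i) (f.facet j) := by
  refine ⟨fun h => hij (f.facet_injective (Subtype.ext h)), ⟨v, f.mem_facet i, f.mem_facet j⟩, ?_⟩
  obtain ⟨k, hki, hkj, hk⟩ : ∃ k, k ≠ i ∧ k ≠ j ∧ ∀ m : Fin 3, m ≠ k → m = i ∨ m = j := by
    revert hij; revert i j; decide
  have hspan : vectorSpan ℝ ((f.facet i : Set E) ∩ f.facet j) = Submodule.span ℝ {f.dir k} := by
    apply le_antisymm
    · have hv : v ∈ (f.facet i : Set E) ∩ f.facet j := ⟨f.mem_facet i, f.mem_facet j⟩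
      rw [vectorSpan_eq_span_vsub_set_right ℝ hv, Submodule.span_le]
      rintro _ ⟨x, ⟨hx1, hx2⟩, rfl⟩
      rw [f.mem_facet_iff] at hx1 hx2
      simp only [vsub_eq_sub, SetLike.mem_coe, Submodule.mem_span_singleton]
      exact ⟨_, (f.sub_eq_smul hx1.1 fun m hm => by
        rcases hk m hm with rfl | rfl
        exacts [hx1.2, hx2.2]).symm⟩
    · rw [Submodule.span_singleton_le_iff_mem]
      obtain ⟨δ, hδ, hmem⟩ := f.exists_pos_add_smul_mem k
      have : (v + δ • f.dir k) -ᵥ v ∈ vectorSpan ℝ ((f.facet i : Set E) ∩ f.facet j) :=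
        vsub_mem_vectorSpan ℝ
          ⟨(f.mem_facet_iff _ _).2 ⟨hmem, by simp [f.functional_add_smul, hki.symm]⟩,
            (f.mem_facet_iff _ _).2 ⟨hmem, by simp [f.functional_add_smul, hkj.symm]⟩⟩
          ⟨f.mem_facet i, f.mem_facet j⟩
      rw [vsub_eq_sub, add_sub_cancel_left] at this
      exact (Submodule.smul_mem_iff _ hδ.ne').1 this
  rw [hdim, polyDim, hspan, finrank_span_singleton (f.dir_ne_zero k)]

/-- The other end of the edge in direction `f.dir j`. -/
theorem exists_vertex_on_edge (hP : IsPolytope P) (j : Fin 3) :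
    ∃ t > (0 : ℝ), v + t • f.dir j ∈ vertices P := by
  set G : Set E := {x | x ∈ P ∧ ∀ i, i ≠ j → f.functional i x = f.functional i v} with hG
  have hGeq : ∀ x ∈ G, x = v + (f.functional j v - f.functional j x) • f.dir j := fun x hx => by
    rw [← f.sub_eq_smul hx.1 hx.2, add_sub_cancel]
  -- The sum of the two functionals other than `j` exposes the edge `G`.
  set l : StrongDual ℝ E := ∑ i, if i = j then 0 else f.functional i with hl
  have hlx : ∀ x, l x = ∑ i, if i = j then 0 else f.functional i x := fun x => by
    rw [hl, sum_apply]
    exact Finset.sum_congr rfl fun i _ => by split_ifs <;> rfl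
  have hle : ∀ x ∈ P, l x ≤ l v := fun x hx => by
    rw [hlx, hlx]
    exact Finset.sum_le_sum fun i _ => by split_ifs <;> [rfl; exact f.functional_le i x hx]
  have hGexp : IsExposed ℝ P G := fun _ => ⟨l, by
    ext x
    constructor
    · rintro ⟨h1, h2⟩
      have : l x = l v := by
        rw [hlx, hlx]
        exact Finset.sum_congr rfl fun i _ => by split_ifs with h <;> [rfl; exact h2 i h]
      exact ⟨h1, fun z hz => by rw [this]; exact hle z hz⟩
    · rintro ⟨h1, h2⟩
      have heq : l x = l v := le_antisymm (hle x h1) (h2 v f.mem)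
      rw [hlx, hlx, Finset.sum_eq_sum_iff_of_le fun i _ => by
        split_ifs <;> [rfl; exact f.functional_le i x h1]] at heq
      exact ⟨h1, fun i hi => by simpa [hi] using heq i (Finset.mem_univ _)⟩⟩
  have hGcomp := hGexp.isCompact hP.isCompact
  obtain ⟨δ, hδ, hmem⟩ := f.exists_pos_add_smul_mem j
  have hδG : v + δ • f.dir j ∈ G :=
    ⟨hmem, fun i hi => by simp [f.functional_add_smul, hi]⟩
  -- Functional `j` decreases along `dir j`, so its minimum on the edge is the far end; an extreme
  -- point of the face of minimisers is a vertex of `P`, and `hδG` shows that it differs from `v`.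
  obtain ⟨x, hx, hxmin⟩ := hGcomp.exists_isMinOn ⟨_, hδG⟩ (f.functional j).continuous.continuousOn
  have hexp : IsExposed ℝ G ((-f.functional j).toExposed G) :=
    ContinuousLinearMap.toExposed.isExposed
  obtain ⟨u, hu⟩ := (hexp.isCompact hGcomp).extremePoints_nonempty
    ⟨x, hx, fun y hy => neg_le_neg (hxmin hy)⟩
  have huG := hexp.isExtreme.extremePoints_subset_extremePoints hu
  have huP := hGexp.isExtreme.extremePoints_subset_extremePoints huG
  have hmax : f.functional j u ≤ f.functional j (v + δ • f.dir j) :=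
    neg_le_neg_iff.1 ((extremePoints_subset hu).2 _ hδG)
  rw [f.functional_add_smul, if_pos rfl] at hmax
  refine ⟨f.functional j v - f.functional j u, by linarith, ?_⟩
  rw [← hGeq u huG.1]
  exact huP

end VertexFrame

end Polytope

end ConvexPolytope

namespace ConvexPolytope

/-! ### Connectivity of the edge graph, Euler's relation and dependences of incidence vectors. -/

section Combinatorics

variable {E : Type*} [NormedAddCommGroup E] [InnerProductSpace ℝ E] {P : Set E}

/-- Pairwise adjacent facets have distinct colours, so the colours at a vertex form a permutation of
`Fin 3`. -/
theorem VertexFrame.exists_coloring (hdim : polyDim P = 3) {c : facets P → Fin 3}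
    (hc : IsFacetColoring P c) {v : E} (f : VertexFrame P v) :
    ∃ f' : VertexFrame P v, ∀ i, c (f'.facet i) = i := by
  have hinj : Function.Injective fun i => c (f.facet i) := fun i j hij => by
    by_contra hne
    exact hc _ _ (f.adjacentFacets hdim hne) hij
  let σ : Equiv.Perm (Fin 3) := (Equiv.ofBijective _ (Finite.injective_iff_bijective.1 hinj)).symm
  exact ⟨f.reindex σ, fun i =>
    (Equiv.ofBijective _ (Finite.injective_iff_bijective.1 hinj)).apply_symm_apply i⟩

theorem VertexFrame.sum_facets [Fintype (facets P)] {M : Type*} [AddCommMonoid M] {v : E}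
    (f : VertexFrame P v) (g : facets P → M) (hg : ∀ F : facets P, v ∉ (F : Set E) → g F = 0) :
    ∑ F, g F = ∑ i, g (f.facet i) := by
  symm
  refine Fintype.sum_of_injective f.facet f.facet_injective _ _ (fun F hF => hg F fun hv => hF ?_)
    fun _ => rfl
  obtain ⟨i, hi⟩ := f.exhaust F hv
  exact ⟨i, hi.symm⟩

/-- Local optimality is global because `x - v` is a nonnegative combination of the edge directions
at `v`. -/
theorem VertexFrame.le_of_forall_dir {v : E} (f : VertexFrame P v) (φ : E →ₗ[ℝ] ℝ) {x : E}
    (hx : x ∈ P) (h : ∀ j, f.functional j x ≠ f.functional j v → 0 ≤ φ (f.dir j)) :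
    φ v ≤ φ x := by
  rw [← sub_nonneg, ← map_sub, f.sub_eq x hx, map_sum]
  refine Finset.sum_nonneg fun j _ => ?_
  rw [map_smul, smul_eq_mul]
  by_cases hj : f.functional j x = f.functional j v
  · rw [hj, sub_self, zero_mul]
  · exact mul_nonneg (sub_nonneg.2 (f.functional_le j x hx)) (h j hj)

/-- This is connectivity by the simplex method. The sum `φ` of the functionals at `w` is maximal on
`P` only at `w`. Among the vertices with a value of `g` other than `g w`, take `u` with `φ` largest:
an ascending edge at `u` would lead to a higher vertex of the same kind, and without one `u`
maximises `φ` on `P`, so `u = w`. -/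
theorem eq_of_edge_invariant [FiniteDimensional ℝ E] (hP : IsPolytope P) {α : Type*}
    (g : vertices P → α) (f : ∀ v : vertices P, VertexFrame P v)
    (h : ∀ v w : vertices P, ∀ j, ∀ t > (0 : ℝ), (w : E) = v + t • (f v).dir j → g w = g v)
    (v w : vertices P) : g v = g w := by
  by_contra hne
  have := hP.finite_vertices.to_subtype
  have := Fintype.ofFinite (vertices P)
  let φ : E →ₗ[ℝ] ℝ := ∑ i, ((f w).functional i : E →ₗ[ℝ] ℝ)
  have hφ : ∀ x, φ x = ∑ i, (f w).functional i x := fun x => by simp [φ]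
  classical
  obtain ⟨u, hu, hmax⟩ := (Finset.univ.filter fun u => g u ≠ g w).exists_max_image
    (fun u => φ u) ⟨v, by simpa using hne⟩
  simp only [Finset.mem_filter, Finset.mem_univ, true_and] at hu hmax
  by_cases hall : ∀ j, φ ((f u).dir j) ≤ 0
  · have hle : φ w ≤ φ u := by
      have := (f u).le_of_forall_dir (-φ) w.2.1 fun j _ => by simpa using hall j
      simpa using this
    rw [hφ, hφ] at hle
    have heq := le_antisymm
      (Finset.sum_le_sum fun i _ => (f w).functional_le i u u.2.1) hle
    rw [Finset.sum_eq_sum_iff_of_le fun i _ => (f w).functional_le i u u.2.1] at heq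
    have huw : (u : E) - w = 0 := by
      rw [(f w).sub_eq u u.2.1]
      exact Finset.sum_eq_zero fun i hi => by rw [heq i hi, sub_self, zero_smul]
    exact hu (by rw [Subtype.ext (sub_eq_zero.1 huw)])
  · push Not at hall
    obtain ⟨j, hj⟩ := hall
    obtain ⟨t, ht, hmem⟩ := (f u).exists_vertex_on_edge hP j
    have hg := h u ⟨_, hmem⟩ j t ht rfl
    have h2 := hmax ⟨_, hmem⟩ (by rw [hg]; exact hu)
    simp only [map_add, map_smul, smul_eq_mul] at h2
    have := mul_pos ht hj
    linarith

open Classical in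
-- Each facet is counted at its unique `φ`-lowest vertex. A facet at `v` has `v` as its lowest
-- vertex iff its two edges at `v` both ascend.
theorem card_facets_eq_sum [FiniteDimensional ℝ E] [Fintype (facets P)] [Fintype (vertices P)]
    (hP : IsPolytope P)
    (f : ∀ v : vertices P, VertexFrame P v) (φ : E →ₗ[ℝ] ℝ)
    (hφ : ∀ v w : vertices P, φ v = φ w → v = w) :
    Fintype.card (facets P) =
      ∑ v, ∑ i, if ∀ j, j ≠ i → 0 < φ ((f v).dir j) then 1 else 0 := by
  let p : facets P → vertices P → Prop := fun F v =>
    (v : E) ∈ (F : Set E) ∧ ∀ w : vertices P, (w : E) ∈ (F : Set E) → φ v ≤ φ w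
  have h1 : ∀ F, ∑ v, (if p F v then 1 else 0) = 1 := fun F => by
    obtain ⟨u, hu, huF⟩ := exists_mem_vertices_of_isFace hP F.2.1 F.2.2.1
    obtain ⟨v, hv, hmin⟩ := (Finset.univ.filter fun w : vertices P =>
      (w : E) ∈ (F : Set E)).exists_min_image (fun w => φ w) ⟨⟨u, hu⟩, by simpa using huF⟩
    simp only [Finset.mem_filter, Finset.mem_univ, true_and] at hv hmin
    rw [Finset.sum_eq_single v]
    · rw [if_pos ⟨hv, fun w hw => hmin w hw⟩]
    · intro w _ hw
      rw [if_neg]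
      rintro ⟨h1, h2⟩
      exact hw (hφ _ _ (le_antisymm (h2 v hv) (hmin w h1)))
    · simp
  have h2 : ∀ v i, p ((f v).facet i) v ↔ ∀ j, j ≠ i → 0 < φ ((f v).dir j) := fun v i => by
    constructor
    · rintro ⟨-, hmin⟩ j hj
      obtain ⟨t, ht, hmem⟩ := (f v).exists_vertex_on_edge hP j
      have hF : (v : E) + t • (f v).dir j ∈ ((f v).facet i : Set E) :=
        ((f v).mem_facet_iff _ _).2 ⟨hmem.1, by simp [(f v).functional_add_smul, hj.symm]⟩
      have hle := hmin ⟨_, hmem⟩ hF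
      have hne : φ v ≠ φ (v + t • (f v).dir j) := fun heq => by
        have := congrArg Subtype.val (hφ v ⟨_, hmem⟩ heq)
        simp [ht.ne', (f v).dir_ne_zero j] at this
      have hlt := lt_of_le_of_ne hle hne
      simp only [map_add, map_smul, smul_eq_mul, lt_add_iff_pos_right] at hlt
      exact (mul_pos_iff_of_pos_left ht).1 hlt
    · intro h
      refine ⟨(f v).mem_facet i, fun w hw => (f v).le_of_forall_dir φ w.2.1 fun j hj => ?_⟩
      have hji : j ≠ i := by
        rintro rfl
        exact hj (((f v).mem_facet_iff _ _).1 hw).2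
      exact (h j hji).le
  calc Fintype.card (facets P) = ∑ F : facets P, ∑ v, (if p F v then 1 else 0) := by
        simp [h1]
    _ = ∑ v, ∑ F : facets P, (if p F v then 1 else 0) := Finset.sum_comm
    _ = _ := Finset.sum_congr rfl fun v _ => by
        rw [(f v).sum_facets (fun F => if p F v then 1 else 0) fun F hF => by
          rw [if_neg fun h => hF h.1]]
        exact Finset.sum_congr rfl fun i _ => by simp only [h2]

open Classical in
theorem sum_forall_dir_pos [FiniteDimensional ℝ E] [Fintype (vertices P)] (hP : IsPolytope P)
    (hne : Nonempty (vertices P))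
    (f : ∀ v : vertices P, VertexFrame P v) (φ : E →ₗ[ℝ] ℝ)
    (hφ : ∀ v w : vertices P, φ v = φ w → v = w) :
    ∑ v, (if ∀ j, 0 < φ ((f v).dir j) then 1 else 0) = 1 := by
  obtain ⟨v, -, hmin⟩ := Finset.univ.exists_min_image (fun w : vertices P => φ w)
    Finset.univ_nonempty
  rw [Finset.sum_eq_single v]
  · rw [if_pos fun j => ?_]
    obtain ⟨t, ht, hmem⟩ := (f v).exists_vertex_on_edge hP j
    have hle := hmin ⟨_, hmem⟩ (Finset.mem_univ _)
    have hne : φ v ≠ φ (v + t • (f v).dir j) := fun heq => by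
      have := congrArg Subtype.val (hφ v ⟨_, hmem⟩ heq)
      simp [ht.ne', (f v).dir_ne_zero j] at this
    have hlt := lt_of_le_of_ne hle hne
    simp only [map_add, map_smul, smul_eq_mul, lt_add_iff_pos_right] at hlt
    exact (mul_pos_iff_of_pos_left ht).1 hlt
  · intro w _ hw
    rw [if_neg fun h => hw (hφ _ _ (le_antisymm
      ((f w).le_of_forall_dir φ v.2.1 fun j _ => (h j).le) (hmin w (Finset.mem_univ _))))]
  · simp

/-- Euler's relation for simple three-dimensional polytopes. -/
theorem two_mul_card_facets [FiniteDimensional ℝ E] [Fintype (facets P)] [Fintype (vertices P)]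
    (hP : IsPolytope P) (hne : Nonempty (vertices P)) (f : ∀ v : vertices P, VertexFrame P v) :
    2 * Fintype.card (facets P) = Fintype.card (vertices P) + 4 := by
  obtain ⟨φ, hφ⟩ := Module.exists_dual_forall_apply_ne_zero (K := ℝ)
    (fun p : {p : vertices P × vertices P // p.1 ≠ p.2} => (p.1.1 : E) - p.1.2)
    (fun p => sub_ne_zero.2 fun h => p.2 (Subtype.ext h))
  have hφ1 : ∀ v w : vertices P, φ v = φ w → v = w := fun v w h => by
    by_contra hvw
    exact hφ ⟨(v, w), hvw⟩ (by simp [h])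
  have hφ2 : ∀ v w : vertices P, (-φ) v = (-φ) w → v = w := fun v w h =>
    hφ1 v w (by simpa using h)
  classical
  have e1 := card_facets_eq_sum hP f φ hφ1
  have e2 := card_facets_eq_sum hP f (-φ) hφ2
  have e3 := sum_forall_dir_pos hP hne f φ hφ1
  have e4 := sum_forall_dir_pos hP hne f (-φ) hφ2
  -- With `k` ascending edges, `v` is lowest in `k.choose 2` of its facets and highest in `(3 -
  -- k).choose 2`. The total is 1 for `k = 1, 2` and 3 for `k = 0, 3`, and the two exceptional cases
  -- occur once each, at the bottom and at the top.
  have key : ∀ v : vertices P,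
      (∑ i, if ∀ j, j ≠ i → 0 < φ ((f v).dir j) then 1 else 0) +
        (∑ i, if ∀ j, j ≠ i → 0 < (-φ) ((f v).dir j) then 1 else 0) =
      1 + 2 * (if ∀ j, 0 < φ ((f v).dir j) then 1 else 0) +
        2 * (if ∀ j, 0 < (-φ) ((f v).dir j) then 1 else 0) := fun v => by
    have hne : ∀ j, φ ((f v).dir j) ≠ 0 := fun j h0 => by
      obtain ⟨t, ht, hmem⟩ := (f v).exists_vertex_on_edge hP j
      have := congrArg Subtype.val (hφ1 v ⟨_, hmem⟩ (by simp [h0]))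
      simp [ht.ne', (f v).dir_ne_zero j] at this
    have hs : ∀ j, (0 < φ ((f v).dir j) ∧ ¬ φ ((f v).dir j) < 0) ∨
        (¬ 0 < φ ((f v).dir j) ∧ φ ((f v).dir j) < 0) := fun j => by
      rcases lt_or_gt_of_ne (hne j) with h | h
      · exact Or.inr ⟨h.not_gt, h⟩
      · exact Or.inl ⟨h, h.not_gt⟩
    rcases hs 0 with ⟨h0, h0'⟩ | ⟨h0, h0'⟩ <;> rcases hs 1 with ⟨h1, h1'⟩ | ⟨h1, h1'⟩ <;>
      rcases hs 2 with ⟨h2, h2'⟩ | ⟨h2, h2'⟩ <;>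
      simp [Fin.forall_fin_succ, h0, h0', h1, h1', h2, h2']
  have hsum := Finset.sum_congr (rfl : (Finset.univ : Finset (vertices P)) = _) fun v _ => key v
  rw [Finset.sum_add_distrib, ← e1, ← e2, Finset.sum_add_distrib, Finset.sum_add_distrib,
    ← Finset.mul_sum, ← Finset.mul_sum, e3, e4] at hsum
  simp only [Finset.sum_const, Finset.card_univ, smul_eq_mul, mul_one] at hsum
  omega

theorem incidenceVector_injective (hP : IsPolytope P) :
    Function.Injective fun F : facets P => incidenceVector P (F : Set E) := by
  intro F G hFG
  refine Subtype.ext (F.2.1.ext_vertices hP G.2.1 fun v hv => ?_)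
  have := congrFun hFG ⟨v, hv⟩
  simp only [incidenceVector] at this
  by_cases h1 : v ∈ (F : Set E) <;> by_cases h2 : v ∈ (G : Set E) <;> simp_all

theorem VertexFrame.sum_smul_incidenceVector [Fintype (facets P)] {v : vertices P}
    (f : VertexFrame P (v : E)) (μ : facets P → ℝ) :
    (∑ F, μ F • incidenceVector P (F : Set E)) v = ∑ i, μ (f.facet i) := by
  rw [Finset.sum_apply, f.sum_facets _ fun F hF => by simp [incidenceVector, hF]]
  exact Finset.sum_congr rfl fun i _ => by simp [incidenceVector, f.mem_facet i]

/-- A linear dependence of the incidence vectors is constant on each colour class. -/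
theorem exists_eq_comp_color [FiniteDimensional ℝ E] [Fintype (facets P)] (hP : IsPolytope P)
    {c : facets P → Fin 3} (f : ∀ v : vertices P, VertexFrame P v)
    (hf : ∀ v i, c ((f v).facet i) = i) (hne : Nonempty (vertices P)) (μ : facets P → ℝ)
    (hμ : ∑ F, μ F • incidenceVector P (F : Set E) = 0) :
    ∃ a : Fin 3 → ℝ, (∀ F, μ F = a (c F)) ∧ ∑ i, a i = 0 := by
  have hsum : ∀ v, ∑ i, μ ((f v).facet i) = 0 := fun v => by
    rw [← (f v).sum_smul_incidenceVector, hμ]; rfl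
  have huniq : ∀ (v : vertices P) (F : facets P), (v : E) ∈ (F : Set E) → F = (f v).facet (c F) :=
    fun v F hF => by
      obtain ⟨i, hi⟩ := (f v).exhaust F hF
      rw [hi, hf]
  have hinv : ∀ v w : vertices P,
      (fun i => μ ((f v).facet i)) = fun i => μ ((f w).facet i) := by
    -- Along the edge in direction `j` the facets of the other two colours persist, and the zero sum
    -- at both ends determines the value of colour `j`.
    refine eq_of_edge_invariant hP (fun v i => μ ((f v).facet i)) f fun v w j t ht hw => ?_
    have hother : ∀ i, i ≠ j → (f w).facet i = (f v).facet i := fun i hi => by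
      have hmem : (w : E) ∈ ((f v).facet i : Set E) := by
        rw [(f v).mem_facet_iff]
        exact ⟨w.2.1, by rw [hw, (f v).functional_add_smul, if_neg hi, sub_zero]⟩
      have := huniq w _ hmem
      rw [hf] at this
      exact this.symm
    have hrest : ∑ i ∈ Finset.univ.erase j, μ ((f w).facet i) =
        ∑ i ∈ Finset.univ.erase j, μ ((f v).facet i) :=
      Finset.sum_congr rfl fun i hi => by rw [hother i (Finset.ne_of_mem_erase hi)]
    have s1 := hsum v
    have s2 := hsum w
    rw [← Finset.add_sum_erase _ _ (Finset.mem_univ j)] at s1 s2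
    funext i
    by_cases hi : i = j
    · subst hi; linarith
    · simp only [hother i hi]
  obtain ⟨v₀⟩ := hne
  refine ⟨fun i => μ ((f v₀).facet i), fun F => ?_, hsum v₀⟩
  obtain ⟨v, hv, hvF⟩ := exists_mem_vertices_of_isFace hP F.2.1 F.2.2.1
  have h1 := congrFun (hinv ⟨v, hv⟩ v₀) (c F)
  have h2 := huniq ⟨v, hv⟩ F hvF
  simp only at h1 ⊢
  rw [← h1, ← h2]

theorem sum_incidenceVector_color [Fintype (facets P)] {c : facets P → Fin 3}
    (f : ∀ v : vertices P, VertexFrame P v) (hf : ∀ v i, c ((f v).facet i) = i) (a : Fin 3 → ℝ) :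
    ∑ F, a (c F) • incidenceVector P (F : Set E) = fun _ => ∑ i, a i := by
  funext v
  rw [(f v).sum_smul_incidenceVector fun F => a (c F)]
  simp only [hf]

end Combinatorics

end ConvexPolytope

namespace ConvexPolytope

/-! ### Hulls of indexed points, and faces read off from affine dependences. -/

section Points

variable {E : Type*} [AddCommGroup E] [Module ℝ E] {ι : Type*} [Fintype ι]

theorem mem_convexHull_image_iff (x : ι → E) (J : Set ι) (y : E) :
    y ∈ convexHull ℝ (x '' J) ↔ ∃ w : ι → ℝ, (∀ i, 0 ≤ w i) ∧ (∀ i, i ∉ J → w i = 0) ∧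
      ∑ i, w i = 1 ∧ ∑ i, w i • x i = y := by
  classical
  constructor
  · intro hy
    have hconv : Convex ℝ {y : E | ∃ w : ι → ℝ, (∀ i, 0 ≤ w i) ∧ (∀ i, i ∉ J → w i = 0) ∧
        ∑ i, w i = 1 ∧ ∑ i, w i • x i = y} := by
      rintro _ ⟨w, hw, hwJ, hw1, rfl⟩ _ ⟨w', hw', hwJ', hw1', rfl⟩ a b ha hb hab
      refine ⟨fun i => a * w i + b * w' i, fun i =>
        add_nonneg (mul_nonneg ha (hw i)) (mul_nonneg hb (hw' i)), fun i hi => by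
          simp [hwJ i hi, hwJ' i hi], ?_, ?_⟩
      · rw [Finset.sum_add_distrib, ← Finset.mul_sum, ← Finset.mul_sum, hw1, hw1']
        simpa using hab
      · simp only [add_smul, mul_smul, Finset.sum_add_distrib, ← Finset.smul_sum]
    refine convexHull_min ?_ hconv hy
    rintro _ ⟨j, hj, rfl⟩
    refine ⟨Pi.single j 1, fun i => ?_, fun i hi => ?_, ?_, ?_⟩
    · by_cases h : i = j
      · subst h; simp
      · simp [h]
    · have : i ≠ j := fun h => hi (h ▸ hj)
      simp [this]
    · simp
    · simp [Pi.single_apply]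
  · rintro ⟨w, hw, hwJ, hw1, rfl⟩
    have hsub : ∀ f : ι → E, ∑ i, w i • f i = ∑ i ∈ Finset.univ.filter (· ∈ J), w i • f i :=
      fun f => by
        rw [Finset.sum_filter]
        exact Finset.sum_congr rfl fun i _ => by
          split_ifs with h
          · rfl
          · rw [hwJ i h, zero_smul]
    rw [hsub]
    refine (convex_convexHull ℝ _).sum_mem (fun i _ => hw i) ?_ fun i hi =>
      subset_convexHull ℝ _ ⟨i, (Finset.mem_filter.1 hi).2, rfl⟩
    rw [← hw1, Finset.sum_filter]
    exact Finset.sum_congr rfl fun i _ => by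
      split_ifs with h
      · rfl
      · rw [hwJ i h]

theorem mem_convexHull_range_iff (x : ι → E) (y : E) :
    y ∈ convexHull ℝ (Set.range x) ↔ ∃ w : ι → ℝ, (∀ i, 0 ≤ w i) ∧
      ∑ i, w i = 1 ∧ ∑ i, w i • x i = y := by
  rw [← Set.image_univ, mem_convexHull_image_iff]
  simp

theorem exists_weights_of_mem_affineSpan_image (x : ι → E) (J : Set ι) {y : E}
    (hy : y ∈ affineSpan ℝ (x '' J)) : ∃ w : ι → ℝ, (∀ i, i ∉ J → w i = 0) ∧
      ∑ i, w i = 1 ∧ ∑ i, w i • x i = y := by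
  classical
  rw [Set.image_eq_range] at hy
  obtain ⟨w, hw, hwy⟩ := eq_affineCombination_of_mem_affineSpan_of_fintype hy
  rw [Finset.affineCombination_eq_linear_combination _ _ _ hw] at hwy
  refine ⟨fun i => if h : i ∈ J then w ⟨i, h⟩ else 0, fun i hi => by simp [hi], ?_, ?_⟩
  · rw [← hw]
    symm
    refine Fintype.sum_of_injective (fun i : J => (i : ι)) Subtype.val_injective _ _
      (fun i hi => ?_) fun i => by simp
    simp only [Subtype.range_coe_subtype, Set.ofPred_mem_eq] at hi
    simp [hi]
  · rw [hwy]
    symm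
    refine Fintype.sum_of_injective (fun i : J => (i : ι)) Subtype.val_injective _ _
      (fun i hi => ?_) fun i => by simp
    simp only [Subtype.range_coe_subtype, Set.ofPred_mem_eq] at hi
    simp [hi]

theorem isPolytope_convexHull_range (x : ι → E) : IsPolytope (convexHull ℝ (Set.range x)) := by
  classical
  exact ⟨Finset.univ.image x, by simp⟩

variable [TopologicalSpace E]

theorem isFace_eq_convexHull_image (x : ι → E) {F : Set E}
    (hF : IsFace (convexHull ℝ (Set.range x)) F) : F = convexHull ℝ (x '' {i | x i ∈ F}) := by
  rcases F.eq_empty_or_nonempty with rfl | hne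
  · simp
  have hexp : IsExposed ℝ (convexHull ℝ (Set.range x)) F := hF
  apply Set.Subset.antisymm
  · intro y hy
    obtain ⟨l, hl⟩ := hF hne
    have hy' := hy
    rw [hl] at hy'
    obtain ⟨hyQ, hmax⟩ := hy'
    obtain ⟨w, hw, hw1, rfl⟩ := (mem_convexHull_range_iff x y).1 hyQ
    have hxQ : ∀ i, x i ∈ convexHull ℝ (Set.range x) := fun i =>
      subset_convexHull ℝ _ ⟨i, rfl⟩
    rw [mem_convexHull_image_iff]
    refine ⟨w, hw, fun i hi => ?_, hw1, rfl⟩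
    set M := l (∑ i, w i • x i) with hM
    -- Complementary slackness: the weighted nonnegative slacks sum to zero, so weight is carried
    -- only by points of `F`.
    have h0 : ∑ j, w j * (M - l (x j)) = 0 := by
      simp only [mul_sub, Finset.sum_sub_distrib, ← Finset.sum_mul, hw1, one_mul]
      rw [sub_eq_zero, hM, map_sum]
      simp
    rw [Finset.sum_eq_zero_iff_of_nonneg fun j _ =>
      mul_nonneg (hw j) (sub_nonneg.2 (hmax _ (hxQ j)))] at h0
    rcases mul_eq_zero.1 (h0 i (Finset.mem_univ _)) with h | h
    · exact h
    · refine absurd ?_ hi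
      change x i ∈ F
      rw [hl]
      exact ⟨hxQ i, fun z hz => by rw [← sub_eq_zero.1 h]; exact hmax z hz⟩
  · refine convexHull_min ?_ (hexp.convex (convex_convexHull ℝ _))
    rintro _ ⟨i, hi, rfl⟩
    exact hi

variable [IsTopologicalAddGroup E] [ContinuousSMul ℝ E] [T2Space E] [FiniteDimensional ℝ E]

/-- A function on the index set is, up to a constant, the restriction of a linear functional if it
is orthogonal to all affine dependences. -/
theorem exists_functional_of_orthogonal (x : ι → E) (c : ι → ℝ)
    (hc : ∀ γ : ι → ℝ, ∑ i, γ i = 0 → ∑ i, γ i • x i = 0 → ∑ i, γ i * c i = 0) :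
    ∃ (l : StrongDual ℝ E) (b : ℝ), ∀ i, l (x i) = b + c i := by
  classical
  let T : (ι → ℝ) →ₗ[ℝ] ℝ × E := Fintype.linearCombination ℝ fun i => ((1 : ℝ), x i)
  have hT : ∀ γ, T γ = (∑ i, γ i, ∑ i, γ i • x i) := fun γ => by
    ext
    · simp [T, Fintype.linearCombination_apply, Prod.fst_sum]
    · simp [T, Fintype.linearCombination_apply, Prod.snd_sum]
  let φ : Module.Dual ℝ (ι → ℝ) := Fintype.linearCombination ℝ c
  have hφ : φ ∈ (LinearMap.ker T).dualAnnihilator := by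
    rw [Submodule.mem_dualAnnihilator]
    intro γ hγ
    rw [LinearMap.mem_ker, hT, Prod.mk_eq_zero] at hγ
    simpa [φ, Fintype.linearCombination_apply] using hc γ hγ.1 hγ.2
  -- A functional vanishing on `ker T` factors through `T`; its value at `(1, 0)` accounts for the
  -- constant.
  rw [← LinearMap.range_dualMap_eq_dualAnnihilator_ker] at hφ
  obtain ⟨m, hm⟩ := hφ
  refine ⟨LinearMap.toContinuousLinearMap (m ∘ₗ LinearMap.inr ℝ ℝ E), -m (1, 0), fun i => ?_⟩
  have h1 : m (1, x i) = c i := by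
    have := LinearMap.congr_fun hm (Pi.single i 1)
    rw [LinearMap.dualMap_apply, hT] at this
    simpa [φ, Fintype.linearCombination_apply, Pi.single_apply] using this
  have h2 : m (1, x i) = m (1, 0) + m (0, x i) := by rw [← map_add]; simp
  simp only [LinearMap.coe_toContinuousLinearMap', LinearMap.comp_apply, LinearMap.inr_apply]
  linarith

/-- By orthogonality `c` is a linear functional up to a constant, and its maximum 0 is attained on
the indices in `J` alone. -/
theorem isFace_convexHull_image (x : ι → E) (J : Set ι) (c : ι → ℝ) (hcJ : ∀ i ∈ J, c i = 0)
    (hc0 : ∀ i, i ∉ J → c i < 0)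
    (hc : ∀ γ : ι → ℝ, ∑ i, γ i = 0 → ∑ i, γ i • x i = 0 → ∑ i, γ i * c i = 0) :
    IsFace (convexHull ℝ (Set.range x)) (convexHull ℝ (x '' J)) := by
  intro hne
  obtain ⟨j, hj⟩ : J.Nonempty := by simpa using hne
  obtain ⟨l, b, hl⟩ := exists_functional_of_orthogonal x c hc
  refine ⟨l, ?_⟩
  have hle : ∀ i, c i ≤ 0 := fun i => by
    by_cases h : i ∈ J
    · exact (hcJ i h).le
    · exact (hc0 i h).le
  have hlw : ∀ w : ι → ℝ, ∑ i, w i = 1 → l (∑ i, w i • x i) = b + ∑ i, w i * c i := fun w hw => by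
    rw [map_sum]
    simp only [map_smul, smul_eq_mul, hl, mul_add, Finset.sum_add_distrib, ← Finset.sum_mul, hw,
      one_mul]
  have hmax : ∀ z ∈ convexHull ℝ (Set.range x), l z ≤ b := fun z hz => by
    obtain ⟨w, hw, hw1, rfl⟩ := (mem_convexHull_range_iff x z).1 hz
    rw [hlw w hw1]
    have := Finset.sum_nonpos fun i (_ : i ∈ Finset.univ) =>
      mul_nonpos_of_nonneg_of_nonpos (hw i) (hle i)
    linarith
  ext y
  constructor
  · intro hy
    obtain ⟨w, hw, hwJ, hw1, rfl⟩ := (mem_convexHull_image_iff x J y).1 hy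
    refine ⟨(mem_convexHull_range_iff x _).2 ⟨w, hw, hw1, rfl⟩, fun z hz => ?_⟩
    rw [hlw w hw1, Finset.sum_eq_zero fun i _ => ?_, add_zero]
    · exact hmax z hz
    · by_cases h : i ∈ J
      · rw [hcJ i h, mul_zero]
      · rw [hwJ i h, zero_mul]
  · rintro ⟨hy, hmaxy⟩
    obtain ⟨w, hw, hw1, rfl⟩ := (mem_convexHull_range_iff x y).1 hy
    have h1 := hmaxy (x j) (subset_convexHull ℝ _ ⟨j, rfl⟩)
    rw [hl, hcJ j hj, hlw w hw1] at h1
    refine (mem_convexHull_image_iff x J _).2 ⟨w, hw, fun i hi => ?_, hw1, rfl⟩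
    have hnonpos : ∀ i ∈ Finset.univ, w i * c i ≤ 0 := fun i _ =>
      mul_nonpos_of_nonneg_of_nonpos (hw i) (hle i)
    have h0 : ∑ i, w i * c i = 0 :=
      le_antisymm (Finset.sum_nonpos hnonpos) (by linarith)
    rw [Finset.sum_eq_zero_iff_of_nonpos hnonpos] at h0
    rcases mul_eq_zero.1 (h0 i (Finset.mem_univ _)) with h | h
    · exact h
    · exact absurd h (hc0 i hi).ne

end Points

/-- The affine dependences of the points `x i` are the multiples of `α`, which has `p` positive,
`q` negative and `r` zero entries. -/
structure IsCircuitConfig {E : Type*} [AddCommGroup E] [Module ℝ E] {ι : Type*} [Fintype ι]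
    (x : ι → E) (α : ι → ℝ) (p q r : ℕ) : Prop where
  sum_eq : ∑ i, α i = 0
  sum_smul_eq : ∑ i, α i • x i = 0
  eq_mul : ∀ γ : ι → ℝ, ∑ i, γ i = 0 → ∑ i, γ i • x i = 0 → ∃ t, ∀ i, γ i = t * α i
  card_pos : Nat.card {i // 0 < α i} = p
  card_neg : Nat.card {i // α i < 0} = q
  card_zero : Nat.card {i // α i = 0} = r

/-! ### Face lattice of a configuration with a single affine dependence. -/

namespace IsCircuitConfig

section Algebra

variable {E : Type*} [AddCommGroup E] [Module ℝ E] {ι : Type*} [Fintype ι]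
  {x : ι → E} {α : ι → ℝ} {p q r : ℕ}

theorem card_eq (h : IsCircuitConfig x α p q r) : Fintype.card ι = p + q + r := by
  classical
  rw [← h.card_pos, ← h.card_neg, ← h.card_zero, Nat.card_eq_fintype_card,
    Nat.card_eq_fintype_card, Nat.card_eq_fintype_card, Fintype.card_subtype,
    Fintype.card_subtype, Fintype.card_subtype, ← Finset.card_univ, ← Finset.card_union_of_disjoint,
    ← Finset.card_union_of_disjoint]
  · congr 1
    ext i
    simpa [or_assoc, or_comm, or_left_comm] using (lt_trichotomy (α i) 0)
  · rw [Finset.disjoint_left]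
    intro i
    simp only [Finset.mem_union, Finset.mem_filter, Finset.mem_univ, true_and]
    rintro (h | h)
    exacts [h.ne', h.ne]
  · rw [Finset.disjoint_left]
    intro i
    simp only [Finset.mem_filter, Finset.mem_univ, true_and]
    exact fun h => h.not_gt

theorem exists_pos_ne (h : IsCircuitConfig x α p q r) (hp : 2 ≤ p) (i : ι) :
    ∃ j, j ≠ i ∧ 0 < α j := by
  have := h.card_pos
  have : Nontrivial {i // 0 < α i} := by
    rw [← Finite.one_lt_card_iff_nontrivial]; omega
  by_cases hi : 0 < α i
  · obtain ⟨j, hj⟩ := exists_ne (⟨i, hi⟩ : {i // 0 < α i})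
    exact ⟨j, fun hji => hj (Subtype.ext hji), j.2⟩
  · obtain ⟨j⟩ : Nonempty {i // 0 < α i} := inferInstance
    exact ⟨j, fun hji => hi (hji ▸ j.2), j.2⟩

theorem exists_neg_ne (h : IsCircuitConfig x α p q r) (hq : 2 ≤ q) (i : ι) :
    ∃ j, j ≠ i ∧ α j < 0 := by
  have := h.card_neg
  have : Nontrivial {i // α i < 0} := by
    rw [← Finite.one_lt_card_iff_nontrivial]; omega
  by_cases hi : α i < 0
  · obtain ⟨j, hj⟩ := exists_ne (⟨i, hi⟩ : {i // α i < 0})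
    exact ⟨j, fun hji => hj (Subtype.ext hji), j.2⟩
  · obtain ⟨j⟩ : Nonempty {i // α i < 0} := inferInstance
    exact ⟨j, fun hji => hi (hji ▸ j.2), j.2⟩

/-- Otherwise subtracting the weights from the unit vector at `i` gives a multiple `t * α` that is
nonpositive away from `i`. Since `α` takes both signs away from `i`, `t = 0`, whereas the entry at
`i` is 1. -/
theorem mem_of_mem_convexHull (h : IsCircuitConfig x α p q r) (hp : 2 ≤ p) (hq : 2 ≤ q)
    {J : Set ι} {i : ι} (hi : x i ∈ convexHull ℝ (x '' J)) : i ∈ J := by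
  classical
  obtain ⟨w, hw, hwJ, hw1, hwx⟩ := (mem_convexHull_image_iff x J _).1 hi
  by_contra hiJ
  obtain ⟨t, ht⟩ := h.eq_mul (fun j => Pi.single (M := fun _ => ℝ) i 1 j - w j)
    (by simp [hw1]) (by simp [sub_smul, Finset.sum_sub_distrib, hwx, Pi.single_apply])
  have hle : ∀ j, j ≠ i → t * α j ≤ 0 := fun j hj => by
    rw [← ht]
    simpa [hj] using hw j
  have hti : t * α i = 1 := by rw [← ht]; simp [hwJ i hiJ]
  obtain ⟨j, hj, hj0⟩ := h.exists_pos_ne hp i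
  obtain ⟨k, hk, hk0⟩ := h.exists_neg_ne hq i
  have h1 := hle j hj
  have h2 := hle k hk
  have ht0 : t = 0 := le_antisymm (by nlinarith) (by nlinarith)
  simp [ht0] at hti

theorem injective (h : IsCircuitConfig x α p q r) (hp : 2 ≤ p) (hq : 2 ≤ q) :
    Function.Injective x := fun i j hij => by
  have : x i ∈ convexHull ℝ (x '' {j}) := by simp [hij]
  exact h.mem_of_mem_convexHull (J := {j}) hp hq this

theorem comp_equiv (h : IsCircuitConfig x α p q r) {κ : Type*} [Fintype κ] (e : κ ≃ ι) :
    IsCircuitConfig (fun k => x (e k)) (fun k => α (e k)) p q r where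
  sum_eq := by rw [Equiv.sum_comp e α, h.sum_eq]
  sum_smul_eq := by rw [Equiv.sum_comp e fun i => α i • x i, h.sum_smul_eq]
  eq_mul γ h1 h2 := by
    obtain ⟨t, ht⟩ := h.eq_mul (fun i => γ (e.symm i)) (by rw [Equiv.sum_comp e.symm γ, h1])
      (by rw [← h2, ← Equiv.sum_comp e]; simp)
    exact ⟨t, fun k => by simpa using ht (e k)⟩
  card_pos := by
    rw [← h.card_pos]
    exact Nat.card_congr (e.subtypeEquiv fun _ => Iff.rfl)
  card_neg := by
    rw [← h.card_neg]
    exact Nat.card_congr (e.subtypeEquiv fun _ => Iff.rfl)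
  card_zero := by
    rw [← h.card_zero]
    exact Nat.card_congr (e.subtypeEquiv fun _ => Iff.rfl)

end Algebra

section Faces

variable {E : Type*} [AddCommGroup E] [Module ℝ E] [TopologicalSpace E] [IsTopologicalAddGroup E]
  [ContinuousSMul ℝ E] [T2Space E] [FiniteDimensional ℝ E] {ι : Type*} [Fintype ι]
  {x : ι → E} {α : ι → ℝ} {p q r : ℕ}

/-- The index sets of the faces. -/
def IsFaceIndex {ι : Type*} (α : ι → ℝ) (J : Set ι) : Prop :=
  {i | 0 < α i} ⊆ J ↔ {i | α i < 0} ⊆ J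

/-- The slacks of an exposing functional are nonnegative, vanish exactly on `J`, and are orthogonal
to `α`. If `J` contains all indices of one sign, the remaining terms have a common sign and must
vanish. Conversely, when indices of both signs or of neither are missing, positive slacks outside
`J` can be balanced. -/
theorem isFace_iff (h : IsCircuitConfig x α p q r) (hp : 2 ≤ p) (hq : 2 ≤ q) (J : Set ι) :
    IsFace (convexHull ℝ (Set.range x)) (convexHull ℝ (x '' J)) ↔ IsFaceIndex α J := by
  classical
  constructor
  · intro hF
    rcases J.eq_empty_or_nonempty with rfl | ⟨j, hj⟩
    · obtain ⟨i₀⟩ : Nonempty {i // 0 < α i} := by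
        have := h.card_pos
        exact (Nat.card_pos_iff.1 (by omega)).1
      obtain ⟨j₀, -, hj₀⟩ := h.exists_neg_ne hq i₀
      exact ⟨fun hs => (hs i₀.2).elim, fun hs => (hs hj₀).elim⟩
    · have hjF : x j ∈ convexHull ℝ (x '' J) := subset_convexHull ℝ _ ⟨j, hj, rfl⟩
      obtain ⟨l, hl⟩ := hF ⟨_, hjF⟩
      have hmem : ∀ i, i ∈ J ↔ ∀ z ∈ convexHull ℝ (Set.range x), l z ≤ l (x i) := fun i => by
        have hxi : x i ∈ convexHull ℝ (Set.range x) := subset_convexHull ℝ _ ⟨i, rfl⟩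
        have h1 : i ∈ J ↔ x i ∈ convexHull ℝ (x '' J) :=
          ⟨fun hi => subset_convexHull ℝ _ ⟨i, hi, rfl⟩, h.mem_of_mem_convexHull hp hq⟩
        rw [h1, hl]
        simp [hxi]
      have hmax := (hmem j).1 hj
      have hle : ∀ i, l (x i) ≤ l (x j) := fun i => hmax _ (subset_convexHull ℝ _ ⟨i, rfl⟩)
      have heq : ∀ i ∈ J, l (x i) = l (x j) := fun i hi =>
        le_antisymm (hle i) ((hmem i).1 hi _ (subset_convexHull ℝ _ ⟨j, rfl⟩))
      have hlt : ∀ i, i ∉ J → l (x i) < l (x j) := fun i hi =>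
        lt_of_le_of_ne (hle i) fun he => hi ((hmem i).2 fun z hz => by rw [he]; exact hmax z hz)
      have hsum : ∑ i, α i * (l (x j) - l (x i)) = 0 := by
        simp only [mul_sub, Finset.sum_sub_distrib, ← Finset.sum_mul, h.sum_eq, zero_mul]
        have := congrArg l h.sum_smul_eq
        rw [map_sum, map_zero] at this
        simpa using this
      constructor
      · intro hA i hi
        by_contra hiJ
        have := Finset.sum_lt_sum (s := Finset.univ) (f := fun i => α i * (l (x j) - l (x i)))
          (g := fun _ => (0 : ℝ)) (fun k _ => by
            by_cases hk : k ∈ J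
            · rw [heq k hk, sub_self, mul_zero]
            · exact mul_nonpos_of_nonpos_of_nonneg (not_lt.1 fun hk0 => hk (hA hk0))
                (sub_nonneg.2 (hle k)))
          ⟨i, Finset.mem_univ _, mul_neg_of_neg_of_pos hi (sub_pos.2 (hlt i hiJ))⟩
        rw [hsum] at this
        simp at this
      · intro hB i hi
        by_contra hiJ
        have := Finset.sum_lt_sum (s := Finset.univ) (g := fun i => α i * (l (x j) - l (x i)))
          (f := fun _ => (0 : ℝ)) (fun k _ => by
            by_cases hk : k ∈ J
            · rw [heq k hk, sub_self, mul_zero]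
            · exact mul_nonneg (not_lt.1 fun hk0 => hk (hB hk0)) (sub_nonneg.2 (hle k)))
          ⟨i, Finset.mem_univ _, mul_pos hi (sub_pos.2 (hlt i hiJ))⟩
        rw [hsum] at this
        simp at this
  · intro hJ
    set a : ι → ℝ := fun i => if i ∈ J then 0 else max (α i) 0 with ha
    set b : ι → ℝ := fun i => if i ∈ J then 0 else max (-α i) 0 with hb
    have ha0 : ∀ i, 0 ≤ a i := fun i => by
      simp only [ha]; split_ifs <;> simp
    have hb0 : ∀ i, 0 ≤ b i := fun i => by
      simp only [hb]; split_ifs <;> simp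
    have hpos : ∀ i, i ∉ J → 0 < α i → 0 < ∑ k, b k := fun i hi hi0 => by
      obtain ⟨k, hk, hkJ⟩ := Set.not_subset.1 (fun hs => hi ((hJ.2 hs) hi0))
      refine Finset.sum_pos' (fun k _ => hb0 k) ⟨k, Finset.mem_univ _, ?_⟩
      have hk : α k < 0 := hk
      simp [hb, hkJ, hk]
    have hneg : ∀ i, i ∉ J → α i < 0 → 0 < ∑ k, a k := fun i hi hi0 => by
      obtain ⟨k, hk, hkJ⟩ := Set.not_subset.1 (fun hs => hi ((hJ.1 hs) hi0))
      refine Finset.sum_pos' (fun k _ => ha0 k) ⟨k, Finset.mem_univ _, ?_⟩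
      have hk : 0 < α k := hk
      simp [ha, hkJ, hk]
    -- Each sign class outside `J` is weighted by the total of the opposite class, so the two
    -- contributions to `∑ α i * c i` cancel. At zero coefficients any negative value serves.
    set c : ι → ℝ := fun i => if i ∈ J then 0 else if 0 < α i then -∑ k, b k
      else if α i < 0 then -∑ k, a k else -1 with hcdef
    refine isFace_convexHull_image x J c (fun i hi => by simp [hcdef, hi]) (fun i hi => ?_)
      fun γ h1 h2 => ?_
    · simp only [hcdef, if_neg hi]
      split_ifs with h1 h2
      · exact neg_neg_of_pos (hpos i hi h1)
      · exact neg_neg_of_pos (hneg i hi h2)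
      · norm_num
    · obtain ⟨t, ht⟩ := h.eq_mul γ h1 h2
      have hac : ∀ i, α i * c i = b i * (∑ k, a k) - a i * ∑ k, b k := fun i => by
        simp only [hcdef, ha, hb]
        split_ifs with h1 h2 h3
        · simp
        · rw [max_eq_left h2.le, max_eq_right (by linarith)]; ring
        · rw [max_eq_right h3.le, max_eq_left (by linarith)]; ring
        · have : α i = 0 := le_antisymm (not_lt.1 h2) (not_lt.1 h3)
          simp [this]
      simp only [ht, mul_assoc, hac]
      rw [← Finset.mul_sum, Finset.sum_sub_distrib, ← Finset.sum_mul, ← Finset.sum_mul]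
      ring

theorem vertices_eq (h : IsCircuitConfig x α p q r) (hp : 2 ≤ p) (hq : 2 ≤ q) :
    vertices (convexHull ℝ (Set.range x)) = Set.range x := by
  apply Set.Subset.antisymm extremePoints_convexHull_subset
  rintro _ ⟨i, rfl⟩
  have hface : IsFace (convexHull ℝ (Set.range x)) (convexHull ℝ (x '' {i})) := by
    rw [h.isFace_iff hp hq]
    obtain ⟨j, hj, hj0⟩ := h.exists_pos_ne hp i
    obtain ⟨k, hk, hk0⟩ := h.exists_neg_ne hq i
    exact ⟨fun hs => absurd (hs hj0) hj, fun hs => absurd (hs hk0) hk⟩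
  rw [Set.image_singleton, convexHull_singleton] at hface
  exact exposedPoints_subset_extremePoints (mem_exposedPoints_iff_exposed_singleton.2 hface)

/-- The face lattice in terms of index sets. -/
noncomputable def faceOrderIso (h : IsCircuitConfig x α p q r) (hp : 2 ≤ p) (hq : 2 ≤ q) :
    {F : Set E // IsFace (convexHull ℝ (Set.range x)) F} ≃o {J : Set ι // IsFaceIndex α J} where
  toFun F := ⟨{i | x i ∈ F.1}, by
    rw [← h.isFace_iff hp hq, ← isFace_eq_convexHull_image x F.2]
    exact F.2⟩
  invFun J := ⟨convexHull ℝ (x '' J.1), (h.isFace_iff hp hq J.1).2 J.2⟩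
  left_inv F := Subtype.ext (isFace_eq_convexHull_image x F.2).symm
  right_inv J := by
    ext i
    exact ⟨h.mem_of_mem_convexHull hp hq, fun hi => subset_convexHull ℝ _ ⟨i, hi, rfl⟩⟩
  map_rel_iff' {F G} := by
    constructor
    · intro hFG
      change F.1 ⊆ G.1
      rw [isFace_eq_convexHull_image x F.2, isFace_eq_convexHull_image x G.2]
      exact convexHull_mono (Set.image_mono hFG)
    · exact fun hFG i hi => hFG hi

/-- `IsFaceIndex` involves only the signs of the coefficients, so any bijection preserving signs
carries one face lattice to the other. -/
theorem combEquiv (h : IsCircuitConfig x α p q r) (hp : 2 ≤ p) (hq : 2 ≤ q)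
    {E' : Type*} [AddCommGroup E'] [Module ℝ E'] [TopologicalSpace E'] [IsTopologicalAddGroup E']
    [ContinuousSMul ℝ E'] [T2Space E'] [FiniteDimensional ℝ E'] {κ : Type*} [Fintype κ]
    {y : κ → E'} {β : κ → ℝ} (h' : IsCircuitConfig y β p q r) :
    CombEquiv (convexHull ℝ (Set.range x)) (convexHull ℝ (Set.range y)) := by
  have hfib : ∀ s : SignType, Nonempty
      ({i // SignType.sign (α i) = s} ≃ {k // SignType.sign (β k) = s}) := fun s => by
    rw [← Finite.card_eq]
    cases s with
    | zero =>
      have h1 := h.card_zero.trans h'.card_zero.symm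
      simpa only [SignType.zero_eq_zero, sign_eq_zero_iff] using h1
    | neg =>
      have h1 := h.card_neg.trans h'.card_neg.symm
      simpa only [SignType.neg_eq_neg_one, sign_eq_neg_one_iff] using h1
    | pos =>
      have h1 := h.card_pos.trans h'.card_pos.symm
      simpa only [SignType.pos_eq_one, sign_eq_one_iff] using h1
  let f : ι ≃ κ := Equiv.ofFiberEquiv (f := fun i => SignType.sign (α i))
    (g := fun k => SignType.sign (β k)) fun s => (hfib s).some
  have hf : ∀ i, SignType.sign (β (f i)) = SignType.sign (α i) := fun i =>
    Equiv.ofFiberEquiv_map (f := fun i => SignType.sign (α i))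
      (g := fun k => SignType.sign (β k)) (fun s => (hfib s).some) i
  have hind : IsFaceIndex (fun i => β (f i)) = IsFaceIndex α := by
    have h1 : {i | 0 < β (f i)} = {i | 0 < α i} := by
      ext i
      simp only [Set.mem_ofPred_eq]
      rw [← sign_eq_one_iff, hf, sign_eq_one_iff]
    have h2 : {i | β (f i) < 0} = {i | α i < 0} := by
      ext i
      simp only [Set.mem_ofPred_eq]
      rw [← sign_eq_neg_one_iff, hf, sign_eq_neg_one_iff]
    funext J
    simp only [IsFaceIndex, h1, h2]
  have g := (h'.comp_equiv f).faceOrderIso hp hq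
  rw [hind, show Set.range (fun i => y (f i)) = Set.range y from f.surjective.range_comp y] at g
  exact ⟨(h.faceOrderIso hp hq).trans g.symm⟩

end Faces

end IsCircuitConfig

end ConvexPolytope

namespace ConvexPolytope

/-! ### Facets of a simplex, and beyond and beneath in barycentric coordinates. -/

section Simplex

variable {E : Type*} [AddCommGroup E] [Module ℝ E] {κ : Type*} [Fintype κ]

theorem vectorSpan_convexHull (s : Set E) : vectorSpan ℝ (convexHull ℝ s) = vectorSpan ℝ s := by
  rw [← direction_affineSpan, affineSpan_convexHull, direction_affineSpan]

theorem affineIndependent_iff_forall_sum {y : κ → E} : AffineIndependent ℝ y ↔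
    ∀ γ : κ → ℝ, ∑ k, γ k = 0 → ∑ k, γ k • y k = 0 → ∀ k, γ k = 0 := by
  classical
  rw [affineIndependent_iff]
  constructor
  · exact fun h γ h1 h2 k => h Finset.univ γ h1 h2 k (Finset.mem_univ k)
  · intro h s w h1 h2 k hk
    have := h (fun k => if k ∈ s then w k else 0) (by simpa using h1)
      (by simpa [ite_smul] using h2) k
    simpa [hk] using this

theorem sum_smul_mem_affineSpan_range (y : κ → E) {b : κ → ℝ} (hb : ∑ k, b k = 1) :
    ∑ k, b k • y k ∈ affineSpan ℝ (Set.range y) := by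
  rw [← Finset.affineCombination_eq_linear_combination _ _ _ hb]
  exact affineCombination_mem_affineSpan hb y

theorem exists_weights_of_mem_affineSpan_range {y : κ → E} {v : E}
    (hv : v ∈ affineSpan ℝ (Set.range y)) :
    ∃ b : κ → ℝ, ∑ k, b k = 1 ∧ v = ∑ k, b k • y k := by
  obtain ⟨b, hb, hv⟩ := eq_affineCombination_of_mem_affineSpan_of_fintype hv
  exact ⟨b, hb, by rw [hv, Finset.affineCombination_eq_linear_combination _ _ _ hb]⟩

theorem exists_extend_by_zero {ι : Type*} [Fintype ι] {s : ι → Prop} [Fintype {i // s i}]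
    (x : ι → E) (γ : {i // s i} → ℝ) :
    ∃ γ' : ι → ℝ, (∀ k : {i // s i}, γ' k = γ k) ∧ (∀ i, ¬ s i → γ' i = 0) ∧
      ∑ i, γ' i = ∑ k, γ k ∧ ∑ i, γ' i • x i = ∑ k, γ k • x k := by
  classical
  refine ⟨fun i => if h : s i then γ ⟨i, h⟩ else 0, fun k => by simp [k.2],
    fun i hi => by simp [hi], ?_, ?_⟩ <;>
  · symm
    refine Fintype.sum_of_injective (fun k : {i // s i} => (k : ι)) Subtype.val_injective _ _
      (fun i hi => ?_) fun k => by simp [k.2]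
    have : ¬ s i := fun h => hi ⟨⟨i, h⟩, rfl⟩
    simp [this]

theorem polyDim_convexHull_image {y : κ → E} (hy : AffineIndependent ℝ y) {J : Set κ}
    (hJ : J.Nonempty) : polyDim (convexHull ℝ (y '' J)) + 1 = J.ncard := by
  classical
  have := Fintype.ofFinite J
  have hcard : Fintype.card J = J.ncard := by
    rw [← Nat.card_coe_set_eq, Nat.card_eq_fintype_card]
  have hpos : 0 < J.ncard := (Set.ncard_pos J.toFinite).2 hJ
  rw [polyDim, vectorSpan_convexHull, Set.image_eq_range]
  have := (hy.comp_embedding (Function.Embedding.subtype (· ∈ J))).finrank_vectorSpan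
    (n := J.ncard - 1) (by rw [hcard]; omega)
  have h2 : Module.finrank ℝ (vectorSpan ℝ (Set.range fun j : J => y j)) = J.ncard - 1 := this
  omega

theorem mem_of_mem_convexHull_of_affineIndependent {κ : Type*} {y : κ → E}
    (hy : AffineIndependent ℝ y) {J : Set κ} {k : κ} (hk : y k ∈ convexHull ℝ (y '' J)) : k ∈ J :=
  (hy.mem_affineSpan_iff k J).1 (convexHull_subset_affineSpan _ hk)

theorem convexHull_compl_singleton_injective {κ : Type*} {y : κ → E} (hy : AffineIndependent ℝ y) :
    Function.Injective fun k => convexHull ℝ (y '' {k}ᶜ) := by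
  intro k k' h
  by_contra hne
  have hmem : y k ∈ convexHull ℝ (y '' {k'}ᶜ) := subset_convexHull ℝ _ ⟨k, hne, rfl⟩
  have h' : convexHull ℝ (y '' {k}ᶜ) = convexHull ℝ (y '' {k'}ᶜ) := h
  rw [← h'] at hmem
  exact mem_of_mem_convexHull_of_affineIndependent hy hmem rfl

variable [TopologicalSpace E]

/-- `l` is constant on the facet opposite `y k` and smaller by `δ` at `y k`, so the coordinate `b k`
measures the signed distance from the facet. -/
theorem functional_of_exposes_facet {y : κ → E} (hy : AffineIndependent ℝ y)
    (hκ : 2 ≤ Fintype.card κ) {b : κ → ℝ} (hb : ∑ k, b k = 1) (k : κ) {l : StrongDual ℝ E}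
    (hl : convexHull ℝ (y '' {k}ᶜ) = {x | x ∈ convexHull ℝ (Set.range y) ∧
      ∀ z ∈ convexHull ℝ (Set.range y), l z ≤ l x}) :
    ∃ δ > 0, ∀ x ∈ convexHull ℝ (y '' {k}ᶜ), l (∑ j, b j • y j) = l x - b k * δ := by
  classical
  have : Nontrivial κ := Fintype.one_lt_card_iff_nontrivial.1 hκ
  obtain ⟨j₀, hj₀⟩ := exists_ne k
  have hmemQ : ∀ j, y j ∈ convexHull ℝ (Set.range y) := fun j => subset_convexHull ℝ _ ⟨j, rfl⟩
  have hmax : ∀ x ∈ convexHull ℝ (y '' {k}ᶜ), x ∈ convexHull ℝ (Set.range y) ∧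
      ∀ z ∈ convexHull ℝ (Set.range y), l z ≤ l x := fun x hx => by rwa [hl] at hx
  have hconst : ∀ x ∈ convexHull ℝ (y '' {k}ᶜ), ∀ x' ∈ convexHull ℝ (y '' {k}ᶜ), l x = l x' :=
    fun x hx x' hx' => le_antisymm ((hmax x' hx').2 x (hmax x hx).1)
      ((hmax x hx).2 x' (hmax x' hx').1)
  have hj₀F : y j₀ ∈ convexHull ℝ (y '' {k}ᶜ) := subset_convexHull ℝ _ ⟨j₀, hj₀, rfl⟩
  have hlt : l (y k) < l (y j₀) := by
    refine lt_of_le_of_ne ((hmax _ hj₀F).2 _ (hmemQ k)) fun heq => ?_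
    have : y k ∈ convexHull ℝ (y '' {k}ᶜ) := by
      rw [hl]
      exact ⟨hmemQ k, fun z hz => by rw [heq]; exact (hmax _ hj₀F).2 z hz⟩
    exact mem_of_mem_convexHull_of_affineIndependent hy this rfl
  refine ⟨l (y j₀) - l (y k), sub_pos.2 hlt, fun x hx => ?_⟩
  rw [hconst x hx _ hj₀F, map_sum]
  simp only [map_smul, smul_eq_mul]
  have hj : ∀ j, b j * l (y j) =
      b j * l (y j₀) - if j = k then b k * (l (y j₀) - l (y k)) else 0 := fun j => by
    split_ifs with h
    · subst h; ring
    · rw [hconst (y j) (subset_convexHull ℝ _ ⟨j, h, rfl⟩) _ hj₀F, sub_zero]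
  simp only [hj, Finset.sum_sub_distrib, ← Finset.sum_mul, hb, one_mul]
  simp

variable [IsTopologicalAddGroup E] [ContinuousSMul ℝ E] [T2Space E] [FiniteDimensional ℝ E]

theorem isFace_simplex {y : κ → E} (hy : AffineIndependent ℝ y) (J : Set κ) :
    IsFace (convexHull ℝ (Set.range y)) (convexHull ℝ (y '' J)) := by
  classical
  refine isFace_convexHull_image y J (fun k => if k ∈ J then 0 else -1) (fun k hk => by simp [hk])
    (fun k hk => by simp [hk]) fun γ h1 h2 => ?_
  simp [affineIndependent_iff_forall_sum.1 hy γ h1 h2]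

/-- A face spanned by `j` vertices has dimension `j - 1`, so a facet omits exactly one. The bound on
the cardinality excludes the point, where omitting a vertex leaves the empty set. -/
theorem mem_facets_simplex_iff {y : κ → E} (hy : AffineIndependent ℝ y)
    (hκ : 2 ≤ Fintype.card κ) (F : Set E) :
    F ∈ facets (convexHull ℝ (Set.range y)) ↔ ∃ k, F = convexHull ℝ (y '' {k}ᶜ) := by
  have hcompl : ∀ k : κ, ({k}ᶜ : Set κ).ncard + 1 = Fintype.card κ := fun k => by
    have := Set.ncard_add_ncard_compl ({k} : Set κ)
    rw [Set.ncard_singleton, Nat.card_eq_fintype_card] at this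
    omega
  have hΔ : polyDim (convexHull ℝ (Set.range y)) + 1 = Fintype.card κ := by
    have : Nonempty κ := Fintype.card_pos_iff.1 (by omega)
    rw [← Set.image_univ, polyDim_convexHull_image hy Set.univ_nonempty, Set.ncard_univ,
      Nat.card_eq_fintype_card]
  constructor
  · rintro ⟨hF, hne, hd⟩
    have hFJ := isFace_eq_convexHull_image y hF
    set J := {k | y k ∈ F} with hJ
    have hJne : J.Nonempty := by
      rw [hFJ] at hne
      simpa using hne
    have h1 := polyDim_convexHull_image hy hJne
    rw [← hFJ] at h1
    have h2 := Set.ncard_add_ncard_compl J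
    rw [Nat.card_eq_fintype_card] at h2
    obtain ⟨k, hk⟩ := Set.ncard_eq_one.1 (show Jᶜ.ncard = 1 by omega)
    exact ⟨k, by rw [← hk, compl_compl]; exact hFJ⟩
  · rintro ⟨k, rfl⟩
    have h1 := hcompl k
    have hne : ({k}ᶜ : Set κ).Nonempty := by
      rw [← Set.ncard_pos (Set.toFinite _)]; omega
    have h2 := polyDim_convexHull_image hy hne
    exact ⟨isFace_simplex hy _, by simpa using hne, by omega⟩

theorem isBeyond_simplex_iff {y : κ → E} (hy : AffineIndependent ℝ y)
    (hκ : 2 ≤ Fintype.card κ) {b : κ → ℝ} (hb : ∑ k, b k = 1) (k : κ) :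
    IsBeyond (convexHull ℝ (Set.range y)) (convexHull ℝ (y '' {k}ᶜ)) (∑ j, b j • y j) ↔
      b k < 0 := by
  have hF := (mem_facets_simplex_iff hy hκ _).2 ⟨k, rfl⟩
  obtain ⟨x, hx⟩ := hF.2.1
  constructor
  · rintro ⟨l, hl, hlt⟩
    obtain ⟨δ, hδ, h⟩ := functional_of_exposes_facet hy hκ hb k hl
    have h1 := hlt x hx
    rw [h x hx] at h1
    by_contra! hbk
    have := mul_nonneg hbk hδ.le
    linarith
  · intro hbk
    obtain ⟨l, hl⟩ := hF.1 hF.2.1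
    obtain ⟨δ, hδ, h⟩ := functional_of_exposes_facet hy hκ hb k hl
    refine ⟨l, hl, fun z hz => ?_⟩
    rw [h z hz]
    have := mul_neg_of_neg_of_pos hbk hδ
    linarith

theorem isBeneath_simplex_iff {y : κ → E} (hy : AffineIndependent ℝ y)
    (hκ : 2 ≤ Fintype.card κ) {b : κ → ℝ} (hb : ∑ k, b k = 1) (k : κ) :
    IsBeneath (convexHull ℝ (Set.range y)) (convexHull ℝ (y '' {k}ᶜ)) (∑ j, b j • y j) ↔
      0 < b k := by
  have hF := (mem_facets_simplex_iff hy hκ _).2 ⟨k, rfl⟩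
  obtain ⟨x, hx⟩ := hF.2.1
  constructor
  · rintro ⟨l, hl, hlt⟩
    obtain ⟨δ, hδ, h⟩ := functional_of_exposes_facet hy hκ hb k hl
    have h1 := hlt x hx
    rw [h x hx] at h1
    by_contra! hbk
    have := mul_nonpos_of_nonpos_of_nonneg hbk hδ.le
    linarith
  · intro hbk
    obtain ⟨l, hl⟩ := hF.1 hF.2.1
    obtain ⟨δ, hδ, h⟩ := functional_of_exposes_facet hy hκ hb k hl
    refine ⟨l, hl, fun z hz => ?_⟩
    rw [h z hz]
    have := mul_pos hbk hδ
    linarith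

theorem ncard_beyond_simplex {y : κ → E} (hy : AffineIndependent ℝ y)
    (hκ : 2 ≤ Fintype.card κ) {b : κ → ℝ} (hb : ∑ k, b k = 1) :
    {F | F ∈ facets (convexHull ℝ (Set.range y)) ∧
      IsBeyond (convexHull ℝ (Set.range y)) F (∑ j, b j • y j)}.ncard =
      Nat.card {k // b k < 0} := by
  have : {F | F ∈ facets (convexHull ℝ (Set.range y)) ∧
      IsBeyond (convexHull ℝ (Set.range y)) F (∑ j, b j • y j)} =
      (fun k => convexHull ℝ (y '' {k}ᶜ)) '' {k | b k < 0} := by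
    ext F
    simp only [Set.mem_ofPred_eq, Set.mem_image, mem_facets_simplex_iff hy hκ]
    constructor
    · rintro ⟨⟨k, rfl⟩, h⟩
      exact ⟨k, (isBeyond_simplex_iff hy hκ hb k).1 h, rfl⟩
    · rintro ⟨k, hk, rfl⟩
      exact ⟨⟨k, rfl⟩, (isBeyond_simplex_iff hy hκ hb k).2 hk⟩
  rw [this, Set.ncard_image_of_injective _ (convexHull_compl_singleton_injective hy)]
  rfl

end Simplex

theorem range_option_elim {ι X : Type*} (a : X) (x : ι → X) :
    Set.range (fun o : Option ι => o.elim a x) = insert a (Set.range x) := by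
  ext z
  simp [Option.exists, eq_comm]

theorem card_subtype_option {ι : Type*} [Finite ι] (s : Option ι → Prop) [Decidable (s none)] :
    Nat.card {o // s o} = Nat.card {i // s (some i)} + if s none then 1 else 0 := by
  classical
  have := Fintype.ofFinite ι
  rw [Nat.card_eq_fintype_card, Nat.card_eq_fintype_card, Fintype.card_subtype,
    Fintype.card_subtype, Finset.card_filter, Finset.card_filter, Fintype.sum_option, add_comm]
  congr

/-! ### Dimension, pyramids and the type `T` from a single dependence. -/

namespace IsCircuitConfig

variable {E : Type*} [AddCommGroup E] [Module ℝ E] {ι : Type*} [Fintype ι]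
  {x : ι → E} {α : ι → ℝ} {p q r : ℕ}

theorem exists_pos (h : IsCircuitConfig x α p q r) (hp : 1 ≤ p) : ∃ i, 0 < α i := by
  have := h.card_pos
  obtain ⟨i⟩ : Nonempty {i // 0 < α i} := (Nat.card_pos_iff.1 (by omega)).1
  exact ⟨i, i.2⟩

/-- A dependence avoiding `i₀` is a multiple of `α` that vanishes where `α` does not, hence is zero.
-/
theorem affineIndependent_ne (h : IsCircuitConfig x α p q r) {i₀ : ι} (hi₀ : α i₀ ≠ 0) :
    AffineIndependent ℝ fun k : {i // i ≠ i₀} => x k := by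
  classical
  rw [affineIndependent_iff_forall_sum]
  intro γ h1 h2 k
  obtain ⟨γ', hk, h0, hs, hsx⟩ := exists_extend_by_zero x γ
  obtain ⟨t, ht⟩ := h.eq_mul γ' (hs.trans h1) (hsx.trans h2)
  have ht0 : t = 0 := by
    have := ht i₀
    rw [h0 i₀ (by simp)] at this
    rcases mul_eq_zero.1 this.symm with h | h
    exacts [h, absurd h hi₀]
  rw [← hk, ht, ht0, zero_mul]

theorem sum_neg_div (h : IsCircuitConfig x α p q r) [DecidableEq ι] {i₀ : ι} (hi₀ : α i₀ ≠ 0) :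
    ∑ k : {i // i ≠ i₀}, -α k / α i₀ = 1 ∧
      ∑ k : {i // i ≠ i₀}, (-α k / α i₀) • x k = x i₀ := by
  have h1 := h.sum_eq
  have h2 := h.sum_smul_eq
  rw [Fintype.sum_eq_add_sum_subtype_ne _ i₀] at h1 h2
  constructor
  · rw [← Finset.sum_div, Finset.sum_neg_distrib, div_eq_one_iff_eq hi₀]
    linarith
  · have h3 : α i₀ • x i₀ = -∑ k : {i // i ≠ i₀}, α k • x k := eq_neg_of_add_eq_zero_left h2
    simp only [neg_smul, div_eq_inv_mul, mul_smul]
    rw [← Finset.smul_sum, Finset.sum_neg_distrib, ← h3, smul_smul, inv_mul_cancel₀ hi₀, one_smul]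

/-- One point of the support lies in the affine span of the others, which are `p + q + r - 1`
independent points. -/
theorem polyDim_eq (h : IsCircuitConfig x α p q r) (hp : 1 ≤ p) (hq : 1 ≤ q) :
    polyDim (convexHull ℝ (Set.range x)) + 2 = p + q + r := by
  classical
  obtain ⟨i₀, hi₀⟩ := h.exists_pos hp
  obtain ⟨hb, hbx⟩ := h.sum_neg_div hi₀.ne'
  have hspan : affineSpan ℝ (Set.range x) =
      affineSpan ℝ (Set.range fun k : {i // i ≠ i₀} => x k) := by
    apply le_antisymm
    · rw [affineSpan_le]
      rintro _ ⟨i, rfl⟩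
      by_cases hi : i = i₀
      · rw [hi, ← hbx]
        exact sum_smul_mem_affineSpan_range _ hb
      · exact mem_affineSpan ℝ ⟨⟨i, hi⟩, rfl⟩
    · refine affineSpan_mono ℝ ?_
      rintro _ ⟨k, rfl⟩
      exact ⟨k, rfl⟩
  have hcard : Fintype.card {i // i ≠ i₀} = p + q + r - 1 := by
    rw [Fintype.card_subtype_compl, h.card_eq]
    simp
  have := (h.affineIndependent_ne hi₀.ne').finrank_vectorSpan (n := p + q + r - 2)
    (by rw [hcard]; omega)
  rw [polyDim, vectorSpan_convexHull, ← direction_affineSpan, hspan, direction_affineSpan, this]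
  omega

theorem restrict (h : IsCircuitConfig x α p q r) [Fintype {i // α i ≠ 0}] :
    IsCircuitConfig (fun k : {i // α i ≠ 0} => x k) (fun k => α k) p q 0 where
  sum_eq := by
    refine Eq.trans ?_ h.sum_eq
    exact Fintype.sum_of_injective (fun k : {i // α i ≠ 0} => (k : ι)) Subtype.val_injective _ _
      (fun i hi => by by_contra hne; exact hi ⟨⟨i, hne⟩, rfl⟩) fun _ => rfl
  sum_smul_eq := by
    refine Eq.trans ?_ h.sum_smul_eq
    exact Fintype.sum_of_injective (fun k : {i // α i ≠ 0} => (k : ι)) Subtype.val_injective _ _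
      (fun i hi => by
        have : α i = 0 := by by_contra hne; exact hi ⟨⟨i, hne⟩, rfl⟩
        simp [this]) fun _ => rfl
  eq_mul γ h1 h2 := by
    obtain ⟨γ', hk, h0, hs, hsx⟩ := exists_extend_by_zero x γ
    obtain ⟨t, ht⟩ := h.eq_mul γ' (hs.trans h1) (hsx.trans h2)
    exact ⟨t, fun k => by rw [← hk, ht]⟩
  card_pos := by
    rw [← h.card_pos]
    exact Nat.card_congr (Equiv.subtypeSubtypeEquivSubtype fun hi => ne_of_gt hi)
  card_neg := by
    rw [← h.card_neg]
    exact Nat.card_congr (Equiv.subtypeSubtypeEquivSubtype fun hi => ne_of_lt hi)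
  card_zero := by
    have : IsEmpty {k : {i // α i ≠ 0} // α k = 0} := ⟨fun k => k.1.2 k.2⟩
    exact Nat.card_of_isEmpty

/-- Expressing `x i` by points of `J` would give a dependence with coefficient 1 at `i`, where `α`
vanishes. This makes the points with coefficient zero apexes. -/
theorem notMem_affineSpan (h : IsCircuitConfig x α p q r) {i : ι} (hi : α i = 0)
    {J : Set ι} (hJ : i ∉ J) : x i ∉ affineSpan ℝ (convexHull ℝ (x '' J)) := by
  classical
  rw [affineSpan_convexHull]
  intro hmem
  obtain ⟨w, hwJ, hw1, hwx⟩ := exists_weights_of_mem_affineSpan_image x J hmem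
  obtain ⟨t, ht⟩ := h.eq_mul (fun j => Pi.single (M := fun _ => ℝ) i 1 j - w j)
    (by simp [hw1]) (by simp [sub_smul, Finset.sum_sub_distrib, hwx, Pi.single_apply])
  have := ht i
  rw [hi, hwJ i hJ] at this
  simp at this

theorem isFoldPyramid (h : IsCircuitConfig x α p q r) :
    IsFoldPyramid (convexHull ℝ (Set.range fun k : {i // α i ≠ 0} => x k)) r
      (convexHull ℝ (Set.range x)) := by
  classical
  have key : ∀ s : Finset ι, (∀ i ∈ s, α i = 0) →
      IsFoldPyramid (convexHull ℝ (Set.range fun k : {i // α i ≠ 0} => x k)) s.card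
        (convexHull ℝ (x '' ({i | α i ≠ 0} ∪ s))) := by
    intro s
    induction s using Finset.induction_on with
    | empty =>
      intro _
      rw [Finset.card_empty, Finset.coe_empty, Set.union_empty, Set.image_eq_range]
      rfl
    | insert a s ha ih =>
      intro hs
      rw [Finset.card_insert_of_notMem ha]
      refine ⟨_, x a, ih fun i hi => hs i (Finset.mem_insert_of_mem hi),
        h.notMem_affineSpan (hs a (Finset.mem_insert_self _ _)) ?_, ?_⟩
      · rintro (h1 | h1)
        · exact h1 (hs a (Finset.mem_insert_self _ _))
        · exact ha h1
      · rw [Set.insert_eq, convexHull_convexHull_union_right, Finset.coe_insert, Set.insert_eq,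
          Set.union_left_comm, Set.image_union, Set.image_singleton]
  have hr : (Finset.univ.filter fun i => α i = 0).card = r := by
    rw [← h.card_zero, Nat.card_eq_fintype_card, Fintype.card_subtype]
  have := key (Finset.univ.filter fun i => α i = 0) (by simp)
  rw [hr] at this
  convert this
  rw [← Set.image_univ]
  congr 1
  ext i
  simp [em']

/-- Adding an apex. -/
theorem option (h : IsCircuitConfig x α p q r) {A : E}
    (hA : A ∉ affineSpan ℝ (convexHull ℝ (Set.range x))) :
    IsCircuitConfig (fun o : Option ι => o.elim A x) (fun o => o.elim 0 α) p q (r + 1) where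
  sum_eq := by simp [Fintype.sum_option, h.sum_eq]
  sum_smul_eq := by simp [Fintype.sum_option, h.sum_smul_eq]
  eq_mul γ h1 h2 := by
    rw [Fintype.sum_option] at h1 h2
    have h0 : γ none = 0 := by
      by_contra hne
      refine hA ?_
      rw [affineSpan_convexHull]
      have hb : ∑ i, -γ (some i) / γ none = 1 := by
        rw [← Finset.sum_div, Finset.sum_neg_distrib, div_eq_one_iff_eq hne]
        linarith
      have : A = ∑ i, (-γ (some i) / γ none) • x i := by
        have h3 : γ none • A = -∑ i, γ (some i) • x i := eq_neg_of_add_eq_zero_left h2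
        simp only [neg_smul, div_eq_inv_mul, mul_smul]
        rw [← Finset.smul_sum, Finset.sum_neg_distrib, ← h3, smul_smul, inv_mul_cancel₀ hne,
          one_smul]
      rw [this]
      exact sum_smul_mem_affineSpan_range _ hb
    obtain ⟨t, ht⟩ := h.eq_mul (fun i => γ (some i)) (by simpa [h0] using h1)
      (by simpa [h0] using h2)
    exact ⟨t, fun o => by cases o with
      | none => simp [h0]
      | some i => exact ht i⟩
  card_pos := by
    classical
    rw [card_subtype_option]
    simpa using h.card_pos
  card_neg := by
    classical
    rw [card_subtype_option]
    simpa using h.card_neg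
  card_zero := by
    classical
    rw [card_subtype_option]
    simpa using h.card_zero

section Topology

variable [TopologicalSpace E] [IsTopologicalAddGroup E] [ContinuousSMul ℝ E] [T2Space E]
  [FiniteDimensional ℝ E]

/-- Omitting a single apex leaves a proper face that still contains the whole support of the
dependence. If it were a simplex, its vertices would be among the independent points spanning it. -/
theorem not_isSimplicial (h : IsCircuitConfig x α p q r) (hp : 2 ≤ p) (hq : 2 ≤ q) (hr : 1 ≤ r) :
    ¬ IsSimplicial (convexHull ℝ (Set.range x)) := by
  classical
  intro hsimp
  have hz := h.card_zero
  obtain ⟨⟨i₀, hi₀⟩⟩ : Nonempty {i // α i = 0} := (Nat.card_pos_iff.1 (by omega)).1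
  have hface : IsFace (convexHull ℝ (Set.range x)) (convexHull ℝ (x '' {i₀}ᶜ)) :=
    (h.isFace_iff hp hq _).2 ⟨fun _ i hi hi' => by
      rw [Set.mem_singleton_iff.1 hi'] at hi; exact hi.ne hi₀, fun _ i hi hi' => by
      rw [Set.mem_singleton_iff.1 hi'] at hi; exact hi.ne' hi₀⟩
  have hne : convexHull ℝ (x '' {i₀}ᶜ) ≠ convexHull ℝ (Set.range x) := fun heq => by
    have hmem : x i₀ ∈ convexHull ℝ (Set.range x) := subset_convexHull ℝ _ ⟨i₀, rfl⟩
    rw [← heq] at hmem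
    exact h.mem_of_mem_convexHull hp hq hmem rfl
  obtain ⟨t, ht, htF⟩ := hsimp _ ⟨hface, hne⟩
  have hexp : IsExposed ℝ (convexHull ℝ (Set.range x)) (convexHull ℝ (x '' {i₀}ᶜ)) := hface
  have hxt : ∀ k : {i // i ≠ i₀}, x k ∈ t := fun k => by
    have h1 : x k ∈ vertices (convexHull ℝ (Set.range x)) := by
      rw [h.vertices_eq hp hq]; exact ⟨k, rfl⟩
    have h2 : x k ∈ convexHull ℝ (x '' {i₀}ᶜ) := subset_convexHull ℝ _ ⟨k, k.2, rfl⟩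
    have h3 : x k ∈ Set.extremePoints ℝ (convexHull ℝ (x '' {i₀}ᶜ)) := by
      rw [hexp.isExtreme.extremePoints_eq]
      exact ⟨h2, h1⟩
    rw [htF] at h3
    exact extremePoints_convexHull_subset h3
  let f : {i // i ≠ i₀} ↪ t := ⟨fun k => ⟨x k, hxt k⟩, fun k k' hk =>
    Subtype.ext (h.injective hp hq (congrArg Subtype.val hk))⟩
  have hind : AffineIndependent ℝ fun k : {i // i ≠ i₀} => x k := ht.comp_embedding f
  have h1 := h.sum_eq
  have h2 := h.sum_smul_eq
  rw [Fintype.sum_eq_add_sum_subtype_ne _ i₀, hi₀] at h1 h2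
  rw [zero_add] at h1
  rw [zero_smul, zero_add] at h2
  obtain ⟨j, hj⟩ := h.exists_pos (by omega)
  have hji : j ≠ i₀ := fun hji => hj.ne' (hji ▸ hi₀)
  exact hj.ne' (affineIndependent_iff_forall_sum.1 hind (fun k => α k) h1 h2 ⟨j, hji⟩)

/-- Removing a point `x i₀` with positive coefficient leaves a simplex in which `x i₀` has
barycentric coordinates `-α k / α i₀`. These are negative at the `p` other positive indices. -/
theorem isT (h : IsCircuitConfig x α (p + 1) q 0) (hp : 1 ≤ p) (hq : 2 ≤ q) :
    IsT (p + q - 1) p (convexHull ℝ (Set.range x)) := by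
  classical
  obtain ⟨i₀, hi₀⟩ := h.exists_pos (by omega)
  obtain ⟨hb, hbx⟩ := h.sum_neg_div hi₀.ne'
  set y : {i // i ≠ i₀} → E := fun k => x k with hy
  have hind : AffineIndependent ℝ y := h.affineIndependent_ne hi₀.ne'
  have hcard : Fintype.card {i // i ≠ i₀} = p + q := by
    rw [Fintype.card_subtype_compl, h.card_eq]
    simp
  have hκ : 2 ≤ Fintype.card {i // i ≠ i₀} := by omega
  have : Nonempty {i // i ≠ i₀} := Fintype.card_pos_iff.1 (by omega)
  have hne0 : ∀ i, α i ≠ 0 := fun i hi => by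
    have := h.card_zero
    rw [Nat.card_eq_zero] at this
    rcases this with h | h
    · exact h.false ⟨i, hi⟩
    · exact h.false
  have hyim : Set.range y = x '' {i₀}ᶜ := by
    rw [Set.image_eq_range]; rfl
  refine ⟨convexHull ℝ (Set.range y), x i₀, ⟨Finset.univ.image y, ?_, by simp⟩, ?_, ?_, ?_, ?_, ?_,
    ?_⟩
  · have := hind.range
    convert this
    all_goals simp
  · have := polyDim_convexHull_image hind Set.univ_nonempty
    rw [Set.image_univ, Set.ncard_univ, Nat.card_eq_fintype_card] at this
    omega
  · rw [affineSpan_convexHull, ← hbx]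
    exact sum_smul_mem_affineSpan_range _ hb
  · intro hmem
    rw [hyim] at hmem
    exact h.mem_of_mem_convexHull (by omega) hq hmem rfl
  · intro F hF
    obtain ⟨k, rfl⟩ := (mem_facets_simplex_iff hind hκ F).1 hF
    rw [← hbx, isBeyond_simplex_iff hind hκ hb, isBeneath_simplex_iff hind hκ hb]
    exact lt_or_gt_of_ne (div_ne_zero (neg_ne_zero.2 (hne0 _)) hi₀.ne')
  · rw [← hbx, ncard_beyond_simplex hind hκ hb]
    have h1 : ∀ k : {i // i ≠ i₀}, -α k / α i₀ < 0 ↔ 0 < α k := fun k => by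
      rw [div_neg_iff]
      constructor
      · rintro (h | h) <;> linarith [h.1, h.2]
      · exact fun h => Or.inr ⟨by linarith, hi₀⟩
    simp only [h1]
    have h2 : (Subtype.val '' {k : {i // i ≠ i₀} | 0 < α k}) = {i | 0 < α i} \ {i₀} := by
      ext i
      simp [and_comm]
    have h3 : {k : {i // i ≠ i₀} | 0 < α k}.ncard = p := by
      rw [← Set.ncard_image_of_injective _ Subtype.val_injective, h2,
        Set.ncard_sdiff_singleton_of_mem (show i₀ ∈ {i | 0 < α i} from hi₀)]
      have : {i | 0 < α i}.ncard = p + 1 := h.card_pos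
      omega
    exact h3
  · rw [Set.insert_eq, convexHull_convexHull_union_right, hyim, ← Set.insert_eq,
      ← Set.image_insert_eq, ← Set.image_univ]
    congr 2
    ext i
    simp [em]

end Topology

end IsCircuitConfig

/-! ### From pyramids over `T` back to a single dependence. -/

section Recognition

universe u

variable {E : Type u} [AddCommGroup E] [Module ℝ E]

theorem IsFoldPyramid.exists_config {K : Set E} {p q s : ℕ}
    (hK : ∃ (ι : Type u) (_ : Fintype ι) (x : ι → E) (α : ι → ℝ),
      IsCircuitConfig x α p q s ∧ K = convexHull ℝ (Set.range x)) :
    ∀ (r : ℕ) {Q : Set E}, IsFoldPyramid K r Q →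
      ∃ (ι : Type u) (_ : Fintype ι) (x : ι → E) (α : ι → ℝ),
        IsCircuitConfig x α p q (s + r) ∧ Q = convexHull ℝ (Set.range x)
  | 0, _, hQ => by
    obtain rfl := hQ
    exact hK
  | r + 1, _, ⟨K', A, hK', hA, hQ⟩ => by
    obtain ⟨ι, _, x, α, hx, rfl⟩ := IsFoldPyramid.exists_config hK r hK'
    refine ⟨Option ι, inferInstance, _, _, hx.option hA, ?_⟩
    rw [hQ, Set.insert_eq, convexHull_convexHull_union_right]
    rw [range_option_elim, Set.insert_eq]

variable [TopologicalSpace E] [IsTopologicalAddGroup E] [ContinuousSMul ℝ E] [T2Space E]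
  [FiniteDimensional ℝ E]

/-- The dependence is `v - ∑ b k • y k = 0` with `b` the barycentric coordinates of `v`: positive at
`v` and at the `k` vertices opposite the facets that `v` is beyond, negative at the other `d + 1 -
k` vertices. -/
theorem IsT.exists_config {d k : ℕ} {Q : Set E} (hQ : IsT d k Q) (hd : 1 ≤ d) :
    ∃ (ι : Type u) (_ : Fintype ι) (x : ι → E) (α : ι → ℝ),
      IsCircuitConfig x α (k + 1) (d + 1 - k) 0 ∧ Q = convexHull ℝ (Set.range x) := by
  classical
  obtain ⟨Δ, v, ⟨t, ht, rfl⟩, hdim, hv, hvΔ, hall, hcount, rfl⟩ := hQ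
  set y : t → E := fun k => k with hy
  have hrange : (t : Set E) = Set.range y := by simp [hy]
  rw [hrange] at hdim hv hvΔ hall hcount ⊢
  rw [affineSpan_convexHull] at hv
  have hne : Nonempty t := by
    by_contra hemp
    rw [not_nonempty_iff] at hemp
    rw [Set.range_eq_empty y, AffineSubspace.span_empty] at hv
    exact AffineSubspace.notMem_bot ℝ E v hv
  have hcard : Fintype.card t = d + 1 := by
    have := polyDim_convexHull_image ht Set.univ_nonempty
    rw [Set.image_univ, Set.ncard_univ, Nat.card_eq_fintype_card] at this
    rw [← this, ← hdim]
  have hκ : 2 ≤ Fintype.card t := by omega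
  obtain ⟨b, hb, rfl⟩ := exists_weights_of_mem_affineSpan_range hv
  have hb0 : ∀ k, b k ≠ 0 := fun k => by
    have := hall _ ((mem_facets_simplex_iff ht hκ _).2 ⟨k, rfl⟩)
    rw [isBeyond_simplex_iff ht hκ hb, isBeneath_simplex_iff ht hκ hb] at this
    exact this.elim (fun h => h.ne) fun h => h.ne'
  rw [ncard_beyond_simplex ht hκ hb] at hcount
  have hpos : Nat.card {k // 0 < b k} = d + 1 - k := by
    rw [Nat.card_eq_fintype_card, Fintype.card_subtype] at hcount ⊢
    have h1 := Finset.card_filter_add_card_filter_not (s := (Finset.univ : Finset t))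
      (fun k => b k < 0)
    have h2 : (Finset.univ.filter fun k => ¬ b k < 0) = Finset.univ.filter fun k => 0 < b k :=
      Finset.filter_congr fun k _ => by
        rw [not_lt]
        exact ⟨fun h => lt_of_le_of_ne h (hb0 k).symm, le_of_lt⟩
    rw [h2, hcount, Finset.card_univ, hcard] at h1
    omega
  refine ⟨Option t, inferInstance, fun o => o.elim (∑ k, b k • y k) y,
    fun o => o.elim 1 fun k => -b k, ⟨?_, ?_, ?_, ?_, ?_, ?_⟩, ?_⟩
  · rw [Fintype.sum_option]
    simp only [Option.elim]
    rw [Finset.sum_neg_distrib, hb, add_neg_cancel]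
  · rw [Fintype.sum_option]
    simp only [Option.elim, neg_smul]
    rw [Finset.sum_neg_distrib, one_smul, add_neg_cancel]
  · intro γ h1 h2
    rw [Fintype.sum_option] at h1 h2
    refine ⟨γ none, fun o => ?_⟩
    have h0 := affineIndependent_iff_forall_sum.1 ht (fun k => γ (some k) + γ none * b k)
      (by rw [Finset.sum_add_distrib, ← Finset.mul_sum, hb]; linarith)
      (by
        simp only [Option.elim] at h2
        simp only [add_smul, mul_smul, Finset.sum_add_distrib, ← Finset.smul_sum]
        rw [add_comm]; exact h2)
    cases o with
    | none => simp
    | some k =>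
      have := h0 k
      simp only [Option.elim]
      linarith
  · rw [card_subtype_option]
    simpa using hcount
  · rw [card_subtype_option]
    simp only [Option.elim, neg_lt_zero]
    rw [hpos]
    norm_num
  · rw [card_subtype_option]
    simp [hb0]
  · rw [Set.insert_eq, convexHull_convexHull_union_right]
    rw [range_option_elim, Set.insert_eq]

end Recognition

end ConvexPolytope

namespace ConvexPolytope

/-! ### The affine dependence of `2m` points on the moment curve in dimension `2m - 2`. -/

section Cyclic

open Polynomial

theorem sum_smul_momentCurve_eq_zero_iff {N d : ℕ} (t γ : Fin N → ℝ) :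
    ∑ i, γ i • (WithLp.toLp 2 (fun j : Fin d => t i ^ ((j : ℕ) + 1)) : EuclideanSpace ℝ (Fin d)) = 0
      ↔ ∀ j : Fin d, ∑ i, γ i * t i ^ ((j : ℕ) + 1) = 0 := by
  have h : ∀ j : Fin d, (∑ i, γ i •
      (WithLp.toLp 2 (fun j : Fin d => t i ^ ((j : ℕ) + 1)) : EuclideanSpace ℝ (Fin d))) j =
      ∑ i, γ i * t i ^ ((j : ℕ) + 1) := fun j => by
    simp [WithLp.ofLp_sum, Finset.sum_apply]
  constructor
  · intro h0 j
    rw [← h, h0]; rfl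
  · intro h0
    ext j
    rw [h, h0]; rfl

/-- The affine dependences of points on the moment curve are orthogonal to the polynomials. -/
theorem momentCurve_dependence_iff {N d : ℕ} (t γ : Fin N → ℝ) :
    (∑ i, γ i = 0 ∧ ∑ i, γ i •
      (WithLp.toLp 2 (fun j : Fin d => t i ^ ((j : ℕ) + 1)) : EuclideanSpace ℝ (Fin d)) = 0) ↔
      ∀ f : ℝ[X], f.natDegree ≤ d → ∑ i, γ i * f.eval (t i) = 0 := by
  rw [sum_smul_momentCurve_eq_zero_iff]
  constructor
  · rintro ⟨h0, h⟩ f hf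
    simp only [eval_eq_sum_range' (Nat.lt_succ_of_le hf), Finset.mul_sum]
    rw [Finset.sum_comm]
    refine Finset.sum_eq_zero fun k hk => ?_
    have hk0 : ∑ i, γ i * t i ^ k = 0 := by
      cases k with
      | zero => simpa using h0
      | succ k => exact h ⟨k, by simpa using hk⟩
    have : ∀ i, γ i * (f.coeff k * t i ^ k) = f.coeff k * (γ i * t i ^ k) := fun i => by ring
    simp only [this, ← Finset.mul_sum, hk0, mul_zero]
  · intro h
    constructor
    · simpa using h 1 (by simp)
    · intro j
      simpa using h (X ^ ((j : ℕ) + 1)) (by rw [natDegree_X_pow]; exact j.2)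

theorem card_odd_fin (m : ℕ) : Nat.card {i : Fin (2 * m) // Odd (i : ℕ)} = m := by
  classical
  rw [Nat.card_eq_fintype_card, Fintype.card_subtype, Finset.card_filter,
    Fin.sum_univ_eq_sum_range (fun i => if Odd i then 1 else 0)]
  induction m with
  | zero => simp
  | succ m ih =>
    rw [show 2 * (m + 1) = 2 * m + 1 + 1 by ring, Finset.sum_range_succ, Finset.sum_range_succ, ih]
    simp

theorem card_not_odd_fin (m : ℕ) : Nat.card {i : Fin (2 * m) // ¬ Odd (i : ℕ)} = m := by
  classical
  have h := card_odd_fin m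
  rw [Nat.card_eq_fintype_card] at h ⊢
  rw [Fintype.card_subtype_compl, h, Fintype.card_fin]
  omega

/-- The coefficients are those of the divided difference at all `2m` nodes, which annihilates
polynomials of degree at most `2m - 2`. Their signs alternate along the curve. -/
theorem cyclic_isCircuitConfig {m : ℕ} (hm : 1 ≤ m) {t : Fin (2 * m) → ℝ} (ht : StrictMono t) :
    IsCircuitConfig (fun i : Fin (2 * m) => (WithLp.toLp 2
      (fun j : Fin (2 * m - 2) => t i ^ ((j : ℕ) + 1)) : EuclideanSpace ℝ (Fin (2 * m - 2))))
      (fun i => Lagrange.nodalWeight Finset.univ t i) m m 0 := by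
  have hinj : Set.InjOn t (Finset.univ : Finset (Fin (2 * m))) := ht.injective.injOn
  have hne : ∀ i, Lagrange.nodalWeight Finset.univ t i ≠ 0 := fun i =>
    Lagrange.nodalWeight_ne_zero hinj (Finset.mem_univ i)
  have hdep : ∀ f : ℝ[X], f.natDegree ≤ 2 * m - 2 →
      ∑ i, Lagrange.nodalWeight Finset.univ t i * f.eval (t i) = 0 := fun f hf => by
    -- The weighted sum of values is the coefficient of `X ^ (2m - 1)`, which is zero for this
    -- degree.
    have := Lagrange.coeff_eq_sum hinj (P := f) (by
      rw [Finset.card_univ, Fintype.card_fin]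
      refine lt_of_le_of_lt degree_le_natDegree ?_
      exact_mod_cast (show f.natDegree < 2 * m by omega))
    rw [Finset.card_univ, Fintype.card_fin, coeff_eq_zero_of_natDegree_lt (by omega)] at this
    rw [this]
    refine Finset.sum_congr rfl fun i _ => ?_
    rw [Lagrange.nodalWeight, Finset.prod_inv_distrib]
    ring
  obtain ⟨hsum, hsmul⟩ := (momentCurve_dependence_iff t _).2 hdep
  have hsign : ∀ i, (0 < Lagrange.nodalWeight Finset.univ t i ↔ Odd (i : ℕ)) ∧
      (Lagrange.nodalWeight Finset.univ t i < 0 ↔ ¬ Odd (i : ℕ)) := fun i => by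
    -- The sign comes from the `2m - 1 - i` factors belonging to nodes larger than `t i`.
    have hprod : ∃ c > 0,
        Lagrange.nodalWeight Finset.univ t i = (-1) ^ (2 * m - 1 - (i : ℕ)) * c := by
      have hsplit : Finset.univ.erase i = Finset.Ioi i ∪ Finset.Iio i := by
        ext j
        simp [lt_or_lt_iff_ne, eq_comm]
      have hdisj : Disjoint (Finset.Ioi i) (Finset.Iio i) := by
        rw [Finset.disjoint_left]
        intro j h1 h2
        exact lt_asymm (Finset.mem_Ioi.1 h1) (Finset.mem_Iio.1 h2)
      refine ⟨(∏ j ∈ Finset.Ioi i, (t j - t i)⁻¹) * ∏ j ∈ Finset.Iio i, (t i - t j)⁻¹,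
        mul_pos (Finset.prod_pos fun j hj => inv_pos.2 (sub_pos.2 (ht (Finset.mem_Ioi.1 hj))))
          (Finset.prod_pos fun j hj => inv_pos.2 (sub_pos.2 (ht (Finset.mem_Iio.1 hj)))), ?_⟩
      have hneg : ∀ j, (t i - t j)⁻¹ = -1 * (t j - t i)⁻¹ := fun j => by
        rw [← neg_sub (t j), inv_neg, neg_one_mul]
      rw [Lagrange.nodalWeight, hsplit, Finset.prod_union hdisj,
        Finset.prod_congr rfl fun j (_ : j ∈ Finset.Ioi i) => hneg j, Finset.prod_mul_distrib,
        Finset.prod_const, Fin.card_Ioi, mul_assoc]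
    obtain ⟨c, hc, hw⟩ := hprod
    rw [hw]
    have hi := i.2
    by_cases hodd : Odd (i : ℕ)
    · have : Even (2 * m - 1 - (i : ℕ)) := by
        obtain ⟨k, hk⟩ := hodd
        exact ⟨m - 1 - k, by omega⟩
      rw [this.neg_one_pow, one_mul]
      exact ⟨⟨fun _ => hodd, fun _ => hc⟩, ⟨fun h => absurd h hc.not_gt, fun h => absurd hodd h⟩⟩
    · have : Odd (2 * m - 1 - (i : ℕ)) := by
        obtain ⟨k, hk⟩ := Nat.not_odd_iff_even.1 hodd
        exact ⟨m - 1 - k, by omega⟩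
      rw [this.neg_one_pow, neg_one_mul]
      exact ⟨⟨fun h => absurd h (by linarith), fun h => absurd h hodd⟩,
        ⟨fun _ => hodd, fun _ => by linarith⟩⟩
  refine ⟨hsum, hsmul, fun γ h1 h2 => ?_, ?_, ?_, ?_⟩
  · have hγ := (momentCurve_dependence_iff t γ).1 ⟨h1, h2⟩
    set i₀ : Fin (2 * m) := ⟨0, by omega⟩ with hi₀
    refine ⟨γ i₀ / Lagrange.nodalWeight Finset.univ t i₀, fun i => ?_⟩
    by_cases hi : i = i₀
    · rw [hi, div_mul_cancel₀ _ (hne i₀)]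
    -- The polynomial vanishing at all nodes except those of `i₀` and `i` has degree `2m - 2`.
    -- Testing both dependences on it leaves two terms each, which fixes the ratio of the
    -- coefficients.
    set s : Finset (Fin (2 * m)) := (Finset.univ.erase i₀).erase i with hs
    have hscard : s.card = 2 * m - 2 := by
      rw [hs, Finset.card_erase_of_mem (Finset.mem_erase.2 ⟨hi, Finset.mem_univ _⟩),
        Finset.card_erase_of_mem (Finset.mem_univ _), Finset.card_univ, Fintype.card_fin]
      omega
    have hpair : ∀ g : Fin (2 * m) → ℝ, ∑ k, g k * (Lagrange.nodal s t).eval (t k) =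
        g i₀ * (Lagrange.nodal s t).eval (t i₀) + g i * (Lagrange.nodal s t).eval (t i) :=
        fun g => by
      rw [← Finset.add_sum_erase _ _ (Finset.mem_univ i₀), ← Finset.add_sum_erase _ _
        (Finset.mem_erase.2 ⟨hi, Finset.mem_univ _⟩), Finset.sum_eq_zero, add_zero]
      intro k hk
      rw [Lagrange.eval_nodal_at_node hk, mul_zero]
    have hdeg : (Lagrange.nodal s t).natDegree ≤ 2 * m - 2 := by
      rw [Lagrange.natDegree_nodal, hscard]
    have e1 := hγ _ hdeg
    have e2 := hdep _ hdeg
    rw [hpair] at e1 e2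
    have hP : (Lagrange.nodal s t).eval (t i) ≠ 0 := by
      rw [Lagrange.eval_nodal]
      exact Finset.prod_ne_zero_iff.2 fun k hk => sub_ne_zero.2 fun h =>
        (Finset.ne_of_mem_erase hk) (ht.injective h).symm
    rw [div_mul_eq_mul_div, eq_div_iff (hne i₀)]
    apply mul_right_cancel₀ hP
    linear_combination Lagrange.nodalWeight Finset.univ t i₀ * e1 - γ i₀ * e2
  · rw [Nat.card_congr (Equiv.subtypeEquivRight fun i => (hsign i).1), card_odd_fin]
  · rw [Nat.card_congr (Equiv.subtypeEquivRight fun i => (hsign i).2), card_not_odd_fin]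
  · have : IsEmpty {i : Fin (2 * m) // Lagrange.nodalWeight Finset.univ t i = 0} :=
      ⟨fun i => hne _ i.2⟩
    exact Nat.card_of_isEmpty

end Cyclic

end ConvexPolytope

namespace ConvexPolytope

/-! ### Gale diagrams on a line. -/

section Gale

variable {E : Type*} [AddCommGroup E] [Module ℝ E]

theorem mem_affineDependences_iff {V : Set E} [Fintype V] (γ : V →₀ ℝ) :
    γ ∈ affineDependences V ↔ ∑ v, γ v = 0 ∧ ∑ v, γ v • (v : E) = 0 := by
  rw [affineDependences, LinearMap.mem_ker, Finsupp.linearCombination_apply,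
    Finsupp.sum_fintype _ _ (by simp), Prod.ext_iff, Prod.fst_sum, Prod.snd_sum]
  simp

/-- Radial normalisation keeps only the sign of `t`; the convention `0⁻¹ = 0` leaves the origin
fixed. -/
theorem norm_inv_smul_eq {a t : ℝ} (ha : a = 0 ∨ a = 1 ∨ a = -1)
    {h : EuclideanSpace ℝ (Fin 1)} (hh : h 0 = t * a) :
    ‖h‖⁻¹ • h = (SignType.sign t : ℝ) • (!₂[a] : EuclideanSpace ℝ (Fin 1)) := by
  have hn : ‖h‖ = |t * a| := by
    rw [EuclideanSpace.norm_eq]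
    simp [Real.sqrt_sq_eq_abs, hh]
  ext j
  fin_cases j
  rw [hn]
  simp only [Fin.zero_eta, PiLp.smul_apply, smul_eq_mul, hh]
  rcases lt_trichotomy t 0 with ht | rfl | ht
  · rcases ha with rfl | rfl | rfl <;> simp [ht, abs_of_neg, ht.ne]
  · simp
  · rcases ha with rfl | rfl | rfl <;> simp [ht, abs_of_pos, ht.ne']

theorem exists_basis_fin_one {M : Type*} [AddCommGroup M] [Module ℝ M] {b : M} (hb : b ≠ 0)
    (hspan : ∀ y : M, ∃ t : ℝ, t • b = y) : ∃ β : Module.Basis (Fin 1) ℝ M, β 0 = b := by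
  have hli : LinearIndependent ℝ fun _ : Fin 1 => b := by
    rw [Fintype.linearIndependent_iff]
    intro g hg i
    fin_cases i
    simpa [hb] using hg
  have htop : ⊤ ≤ Submodule.span ℝ (Set.range fun _ : Fin 1 => b) := by
    rintro y -
    rw [Set.range_const, Submodule.mem_span_singleton]
    exact hspan y
  exact ⟨Module.Basis.mk hli htop, Module.Basis.mk_apply hli htop 0⟩

/-- A basis of the line of dependences is a nonzero multiple of `a`, and after normalisation only
the sign of the factor remains. Conversely `a` and `-a` are themselves Gale transforms, unchanged by
normalisation. -/
theorem isGaleDiagram_iff {V : Set E} [Fintype V] {a : V → ℝ} {p q r : ℕ}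
    (h : IsCircuitConfig (fun v : V => (v : E)) a p q r) (hp : 1 ≤ p)
    (ha : ∀ v, a v = 0 ∨ a v = 1 ∨ a v = -1) (g : V → EuclideanSpace ℝ (Fin 1)) :
    IsGaleDiagram V g ↔ g = (fun v => !₂[a v]) ∨ g = -fun v => !₂[a v] := by
  classical
  obtain ⟨v₀, hv₀⟩ := h.exists_pos hp
  constructor
  · rintro ⟨k, ⟨β, hβ⟩, hg⟩
    obtain ⟨h1, h2⟩ := (mem_affineDependences_iff _).1 (β 0).2
    obtain ⟨t, ht⟩ := h.eq_mul _ h1 h2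
    have hgv : ∀ v, g v = (SignType.sign t : ℝ) • (!₂[a v] : EuclideanSpace ℝ (Fin 1)) :=
      fun v => by rw [hg, norm_inv_smul_eq (ha v) ((hβ v 0).trans (ht v))]
    rcases lt_trichotomy t 0 with h0 | h0 | h0
    · right
      funext v
      rw [hgv]
      simp [h0]
    · refine absurd ?_ (β.ne_zero 0)
      ext v
      rw [ht, h0, zero_mul]
      rfl
    · left
      funext v
      rw [hgv]
      simp [h0]
  · intro hg
    obtain ⟨ε, hε, hgε⟩ : ∃ ε : ℝ, (ε = 1 ∨ ε = -1) ∧ ∀ v, g v = !₂[ε * a v] := by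
      rcases hg with rfl | rfl
      · exact ⟨1, Or.inl rfl, fun v => by simp⟩
      · refine ⟨-1, Or.inr rfl, fun v => ?_⟩
        ext j
        fin_cases j
        simp
    have hε0 : ε ≠ 0 := by rcases hε with rfl | rfl <;> norm_num
    let b : affineDependences V := ⟨Finsupp.equivFunOnFinite.symm fun v => ε * a v,
      (mem_affineDependences_iff _).2 ⟨by
        simp only [Finsupp.equivFunOnFinite_symm_apply_apply, ← Finset.mul_sum, h.sum_eq, mul_zero],
      by simp only [Finsupp.equivFunOnFinite_symm_apply_apply, mul_smul, ← Finset.smul_sum,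
          h.sum_smul_eq, smul_zero]⟩⟩
    have hb : ∀ v, (b : V →₀ ℝ) v = ε * a v := fun v => rfl
    have hb0 : b ≠ 0 := fun hb0 => by
      have : (b : V →₀ ℝ) v₀ = 0 := by
        rw [hb0]; rfl
      rw [hb] at this
      exact mul_ne_zero hε0 hv₀.ne' this
    have hspan : ∀ γ : affineDependences V, ∃ t : ℝ, t • b = γ := fun γ => by
      obtain ⟨h1, h2⟩ := (mem_affineDependences_iff _).1 γ.2
      obtain ⟨t, ht⟩ := h.eq_mul _ h1 h2
      refine ⟨t / ε, ?_⟩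
      ext v
      rw [ht]
      change t / ε * (ε * a v) = t * a v
      field_simp
    obtain ⟨β, hβ⟩ := exists_basis_fin_one (M := affineDependences V) hb0 hspan
    refine ⟨g, ⟨β, fun v j => ?_⟩, fun v => ?_⟩
    · fin_cases j
      change g v 0 = (β 0 : V →₀ ℝ) v
      rw [hβ, hb, hgε]
      rfl
    · have hεa : ε * a v = 0 ∨ ε * a v = 1 ∨ ε * a v = -1 := by
        rcases hε with rfl | rfl <;> rcases ha v with h | h | h <;> simp [h]
      have := norm_inv_smul_eq (t := 1) hεa (h := g v) (by rw [hgε]; simp)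
      rw [this, hgε]
      simp

end Gale

/-! ### The single dependence of the incidence vectors. -/

section Incidence

variable {E : Type*} [NormedAddCommGroup E] [InnerProductSpace ℝ E]
  {P : Set E} {c : facets P → Fin 3}

/-- The coefficients of the affine dependence of the incidence vectors, by colour. -/
def colorSign : Fin 3 → ℝ := ![-1, 1, 0]

theorem card_color (i : Fin 3) : Nat.card {F : facets P // c F = i} = colorCount P c i := rfl

theorem sum_comp_color [Fintype (facets P)] (a : Fin 3 → ℝ) :
    ∑ F, a (c F) = ∑ i, (colorCount P c i : ℝ) * a i := by
  classical
  rw [← Finset.sum_fiberwise Finset.univ c]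
  refine Finset.sum_congr rfl fun i _ => ?_
  rw [← card_color, Nat.card_eq_fintype_card, Fintype.card_subtype,
    Finset.sum_congr rfl fun F hF => by rw [(Finset.mem_filter.1 hF).2], Finset.sum_const,
    nsmul_eq_mul]

theorem colorSign_pos_iff (i : Fin 3) : 0 < colorSign i ↔ i = 1 := by
  fin_cases i <;> simp [colorSign]

theorem colorSign_neg_iff (i : Fin 3) : colorSign i < 0 ↔ i = 0 := by
  fin_cases i <;> simp [colorSign]

theorem colorSign_eq_zero_iff (i : Fin 3) : colorSign i = 0 ↔ i = 2 := by
  fin_cases i <;> simp [colorSign]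

theorem incidence_isCircuitConfig [FiniteDimensional ℝ E] [Fintype (facets P)] (hP : IsPolytope P)
    (hne : Nonempty (vertices P))
    (f : ∀ v : vertices P, VertexFrame P v) (hf : ∀ v i, c ((f v).facet i) = i)
    (h32 : colorCount P c 1 < colorCount P c 2) (h21 : colorCount P c 1 = colorCount P c 0) :
    IsCircuitConfig (fun F : facets P => incidenceVector P (F : Set E))
      (fun F => colorSign (c F)) (colorCount P c 1) (colorCount P c 0) (colorCount P c 2) where
  sum_eq := by
    rw [sum_comp_color, Fin.sum_univ_three, h21]
    simp [colorSign]
  sum_smul_eq := by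
    rw [sum_incidenceVector_color f hf, Fin.sum_univ_three]
    funext v
    simp [colorSign]
  eq_mul γ h1 h2 := by
    obtain ⟨a, ha, hsum⟩ := exists_eq_comp_color hP f hf hne γ h2
    simp only [ha] at h1
    rw [sum_comp_color, Fin.sum_univ_three, h21] at h1
    rw [Fin.sum_univ_three] at hsum
    rw [h21] at h32
    have h32' : (colorCount P c 0 : ℝ) < colorCount P c 2 := by exact_mod_cast h32
    -- Subtracting `colorCount P c 0` times `∑ a i = 0` from the weighted relation leaves only the
    -- term of the third colour, with a nonzero factor.
    have h2 : a 2 = 0 := by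
      have : ((colorCount P c 2 : ℝ) - colorCount P c 0) * a 2 = 0 := by
        linear_combination h1 - (colorCount P c 0 : ℝ) * hsum
      exact (mul_eq_zero.1 this).resolve_left (sub_ne_zero.2 h32'.ne')
    refine ⟨a 1, fun F => ?_⟩
    rw [ha]
    generalize c F = i
    fin_cases i
    · simp [colorSign]; linarith
    · simp [colorSign]
    · simp [colorSign, h2]
  card_pos := by simp only [colorSign_pos_iff, card_color]
  card_neg := by simp only [colorSign_neg_iff, card_color]
  card_zero := by simp only [colorSign_eq_zero_iff, card_color]

end Incidence

end ConvexPolytope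

/-! ### The incidence polytope: assembling the results. -/

theorem proposition3 {D n : ℕ} (P : Set (EuclideanSpace ℝ (Fin D)))
    (hP : IsPolytope P) (hdim : polyDim P = 3) (hsimple : IsSimple P)
    (c : facets P → Fin 3) (hc : IsFacetColoring P c)
    (hn : (vertices P).ncard = 2 * n)
    (m₁ m₂ m₃ : ℕ) (hm₁ : m₁ = colorCount P c 0) (hm₂ : m₂ = colorCount P c 1)
    (hm₃ : m₃ = colorCount P c 2)
    (h32 : m₂ < m₃) (h21 : m₂ = m₁) (h1 : 2 ≤ m₁) :
    -- the vertices are the incidence vectors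
    vertices (incidencePolytope P) = incidenceSet P ∧
    -- the Gale diagram, unique up to the reflection of the line
    (∀ g : vertices (incidencePolytope P) → EuclideanSpace ℝ (Fin 1),
      IsGaleDiagram (vertices (incidencePolytope P)) g ↔
        (g = lineDiagram P c ∨ g = -lineDiagram P c)) ∧
    (∀ g : vertices (incidencePolytope P) → EuclideanSpace ℝ (Fin 1),
      IsGaleDiagram (vertices (incidencePolytope P)) g →
        {w | g w = !₂[(0 : ℝ)]}.ncard = m₃ ∧
        {w | g w = !₂[(1 : ℝ)]}.ncard = m₂ ∧
        {w | g w = !₂[(-1 : ℝ)]}.ncard = m₁) ∧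
    -- the faces
    (∀ J : Set (vertices P → ℝ), J ⊂ incidenceSet P →
      (IsProperFace (incidencePolytope P) (convexHull ℝ J) ↔
        ((¬ colorVectors P c 0 ⊆ J ∧ ¬ colorVectors P c 1 ⊆ J) ∨
          colorVectors P c 0 ∪ colorVectors P c 1 ⊆ J))) ∧
    ¬ IsSimplicial (incidencePolytope P) ∧
    -- the pyramid
    polyDim (incidencePolytope P) = n ∧
    (∃ K : Set (vertices P → ℝ),
      IsPolytope K ∧ IsFoldPyramid K m₃ (incidencePolytope P) ∧
      polyDim K = 2 * m₂ - 2 ∧ (vertices K).ncard = 2 * m₂ ∧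
      ∀ t : Fin (2 * m₂) → ℝ, StrictMono t →
        CombEquiv K (cyclicPolytope (2 * m₂ - 2) t)) ∧
    -- the combinatorial type `T^{n,m₃}_{m₂-1}`
    IsTPyramid n m₃ (m₂ - 1) (incidencePolytope P) ∧
    (∀ (N : ℕ) (R : Set (EuclideanSpace ℝ (Fin N))),
      IsTPyramid n m₃ (m₂ - 1) R → CombEquiv (incidencePolytope P) R) := by
  classical
  have := hP.finite_vertices.to_subtype
  have := hP.finite_facets.to_subtype
  have := Fintype.ofFinite (vertices P)
  have := Fintype.ofFinite (facets P)
  have hPne : P.Nonempty := by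
    rw [Set.nonempty_iff_ne_empty]
    rintro rfl
    rw [polyDim, vectorSpan_empty, finrank_bot] at hdim
    omega
  have hne : Nonempty (vertices P) := by
    obtain ⟨v, hv⟩ := hP.isCompact.extremePoints_nonempty hPne
    exact ⟨⟨v, hv⟩⟩
  have hframe : ∀ v : vertices P, ∃ f : VertexFrame P (v : EuclideanSpace ℝ (Fin D)),
      ∀ i, c (f.facet i) = i := fun v =>
    (exists_vertexFrame hP hdim hsimple v.2).some.exists_coloring hdim hc
  choose f hf using hframe
  have hcard : Fintype.card (facets P) = n + 2 := by
    have h := two_mul_card_facets hP hne f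
    have hv : Fintype.card (vertices P) = 2 * n := by
      rw [← hn, ← Nat.card_coe_set_eq, Nat.card_eq_fintype_card]
    omega
  have hconf := incidence_isCircuitConfig hP hne f hf (hm₂ ▸ hm₃ ▸ h32) (by rw [← hm₂, ← hm₁, h21])
  rw [← hm₁, ← hm₂, ← hm₃] at hconf
  have hsumcard := hconf.card_eq
  set x : facets P → vertices P → ℝ := fun F => incidenceVector P F with hx
  set α : facets P → ℝ := fun F => colorSign (c F) with hα
  have hp2 : 2 ≤ m₂ := by omega
  have hxinj : Function.Injective x := incidenceVector_injective hP
  have hS : incidenceSet P = Set.range x := by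
    rw [incidenceSet, Set.image_eq_range]
  have hQ : incidencePolytope P = convexHull ℝ (Set.range x) := by rw [incidencePolytope, hS]
  have hV : vertices (incidencePolytope P) = Set.range x := by rw [hQ, hconf.vertices_eq hp2 h1]
  have hcolor : ∀ i F, x F ∈ colorVectors P c i ↔ c F = i := fun i F => by
    constructor
    · rintro ⟨G, hG, hFG⟩
      rw [hxinj hFG, hG]
    · exact fun h => ⟨F, h, rfl⟩
  have hcolor' : ∀ i (J : Set (vertices P → ℝ)),
      colorVectors P c i ⊆ J ↔ {F | c F = i} ⊆ x ⁻¹' J := fun i J => by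
    constructor
    · exact fun h F hF => h ((hcolor i F).2 hF)
    · rintro h _ ⟨F, hF, rfl⟩
      exact h hF
  -- Gale diagrams are indexed by the vertices of the polytope, the dependence by the facets of `P`;
  -- `σ` translates.
  let σ : vertices (incidencePolytope P) ≃ facets P :=
    (Equiv.setCongr hV).trans (Equiv.ofInjective x hxinj).symm
  have hσ : ∀ w : vertices (incidencePolytope P), x (σ w) = w := fun w => by
    have := (Equiv.ofInjective x hxinj).apply_symm_apply (Equiv.setCongr hV w)
    exact congrArg Subtype.val this
  have := Fintype.ofEquiv _ σ.symm
  have hconfV := hconf.comp_equiv σ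
  simp only [hσ] at hconfV
  have hval : ∀ w, α (σ w) = 0 ∨ α (σ w) = 1 ∨ α (σ w) = -1 := fun w => by
    simp only [hα]
    generalize c (σ w) = i
    fin_cases i <;> simp [colorSign]
  have hline : lineDiagram P c = fun w => (!₂[α (σ w)] : EuclideanSpace ℝ (Fin 1)) := by
    funext w
    rw [lineDiagram, ← hσ w, hcolor, hcolor]
    simp only [hα]
    generalize c (σ w) = i
    fin_cases i <;> simp [colorSign]
  have hgale : ∀ g : vertices (incidencePolytope P) → EuclideanSpace ℝ (Fin 1),
      IsGaleDiagram (vertices (incidencePolytope P)) g ↔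
        (g = lineDiagram P c ∨ g = -lineDiagram P c) := fun g => by
    rw [hline]
    exact isGaleDiagram_iff hconfV (by omega) hval g
  have hres := hconf.restrict
  have hKT : IsT (2 * m₂ - 2) (m₂ - 1)
      (convexHull ℝ (Set.range fun k : {F // α F ≠ 0} => x k)) := by
    have h := hres
    rw [show m₂ = (m₂ - 1) + 1 by omega] at h
    have := h.isT (by omega) h1
    rwa [show m₂ - 1 + m₁ - 1 = 2 * m₂ - 2 by omega] at this
  have hpyr := hconf.isFoldPyramid
  rw [← hQ] at hpyr
  refine ⟨hV.trans hS.symm, hgale, fun g hg => ?_, fun J hJ => ?_, ?_, ?_, ?_, ?_, ?_⟩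
  · have hz : {w | α (σ w) = 0}.ncard = m₃ := hconfV.card_zero
    have hpos : {w | α (σ w) = 1}.ncard = m₂ := by
      refine Eq.trans (congrArg Set.ncard ?_) hconfV.card_pos
      ext w
      change α (σ w) = 1 ↔ 0 < α (σ w)
      rcases hval w with h | h | h <;> rw [h] <;> norm_num
    have hneg : {w | α (σ w) = -1}.ncard = m₁ := by
      refine Eq.trans (congrArg Set.ncard ?_) hconfV.card_neg
      ext w
      change α (σ w) = -1 ↔ α (σ w) < 0
      rcases hval w with h | h | h <;> rw [h] <;> norm_num
    have hpt : ∀ a b : ℝ, (!₂[a] : EuclideanSpace ℝ (Fin 1)) = !₂[b] ↔ a = b := fun a b => by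
      simp
    have hnpt : ∀ a b : ℝ, -(!₂[a] : EuclideanSpace ℝ (Fin 1)) = !₂[b] ↔ a = -b := fun a b => by
      have : -(!₂[a] : EuclideanSpace ℝ (Fin 1)) = !₂[-a] := by
        ext j
        fin_cases j
        simp
      rw [this, hpt, neg_eq_iff_eq_neg]
    rcases (hgale g).1 hg with rfl | rfl
    · simp only [hline, hpt]
      exact ⟨hz, hpos, hneg⟩
    · simp only [hline, Pi.neg_apply, hnpt, neg_zero, neg_neg]
      -- Reflection exchanges the points at `1` and `-1`; the counts survive because `m₂ = m₁`.
      exact ⟨hz, hneg.trans h21.symm, hpos.trans h21⟩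
  · have hJx : J = x '' (x ⁻¹' J) := by
      rw [Set.image_preimage_eq_inter_range, ← hS, Set.inter_eq_left.2 hJ.1]
    have hne : convexHull ℝ J ≠ convexHull ℝ (Set.range x) := fun heq => by
      obtain ⟨z, hz, hzJ⟩ := Set.exists_of_ssubset hJ
      rw [hS] at hz
      obtain ⟨F, rfl⟩ := hz
      have hmem : x F ∈ convexHull ℝ (Set.range x) := subset_convexHull ℝ _ ⟨F, rfl⟩
      rw [← heq, hJx] at hmem
      exact hzJ (hconf.mem_of_mem_convexHull hp2 h1 hmem)
    have hface := hconf.isFace_iff hp2 h1 (x ⁻¹' J)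
    rw [← hJx, IsCircuitConfig.IsFaceIndex] at hface
    simp only [hα, colorSign_pos_iff, colorSign_neg_iff] at hface
    rw [← hcolor', ← hcolor'] at hface
    rw [IsProperFace, hQ, Set.union_subset_iff, hface]
    -- The face criterion says that `J` contains both of the first two colour classes or neither.
    tauto
  · rw [hQ]
    exact hconf.not_isSimplicial hp2 h1 (by omega)
  · have := hconf.polyDim_eq (by omega) (by omega)
    rw [hQ]
    omega
  · refine ⟨_, isPolytope_convexHull_range _, hpyr, ?_, ?_, fun t ht => ?_⟩
    · have := hres.polyDim_eq (by omega) (by omega)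
      omega
    · rw [hres.vertices_eq hp2 h1, ← Set.image_univ,
        Set.ncard_image_of_injective _ (hres.injective hp2 h1), Set.ncard_univ,
        Nat.card_eq_fintype_card, hres.card_eq]
      omega
    · subst h21
      exact hres.combEquiv hp2 hp2 (cyclic_isCircuitConfig (by omega) ht)
  · exact ⟨2 * m₂ - 2, _, by omega, hKT, hpyr⟩
  · rintro N R ⟨e, K, he, hK, hR⟩
    -- Counting facets gives `n + 2 = m₂ + m₁ + m₃`, which fixes the dimension of the basis of any
    -- such pyramid.
    have he2 : e = 2 * m₂ - 2 := by omega
    obtain ⟨κ, _, y, β, hy, rfl⟩ := hR.exists_config (hK.exists_config (by omega))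
    rw [show m₂ - 1 + 1 = m₂ by omega, show e + 1 - (m₂ - 1) = m₁ by omega, zero_add] at hy
    rw [hQ]
    exact hconf.combEquiv hp2 h1 hy
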